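/- Let $\mathcal M_\delta$ be the space of locally finite point measures on $\mathbb R^d$, i.e. the Radon measures $\mu=\sum_{i\in I}\delta_{x_i}$ with $I$ finite or countable. For Borel $U\subset\mathbb R^d$ let $\mathcal F_U$ be the $\sigma$-algebra on $\mathcal M_\delta$ generated by the maps $\mu\mapsto\mu(V)$, $V\subset U$ Borel, and put $\mathcal F=\mathcal F_{\mathbb R^d}$. Let $\rho>0$, let $\mathbb P_\rho$ be the law on $(\mathcal M_\delta,\mathcal F)$ of the Poisson point process on $\mathbb R^d$ of density $\rho$, and let $\mathbb E_\rho$ be its expectation. Write $Q_s=[-\frac s2,\frac s2]^d$. For $h\in\mathbb R^d$ let $\tau_h\mu$ be the image of $\mu$ under $x\mapsto x+h$, and for $f:\mathcal M_\delta\to\mathbb R$ put $\tau_hf(\mu)=f(\tau_{-h}\mu)$. Let $C_c^\infty$ be the set of bounded functions $f:\mathcal M_\delta\to\mathbb R$ that are $\mathcal F_V$-measurable for some compact $V\subset\mathbb R^d$ and for which, for every $N\in\mathbb N$, the function $(x_1,\dots,x_N)\mapsto f(\sum_{i=1}^N\delta_{x_i})$ is infinitely differentiable on $(\mathbb R^d)^N$.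 For such $f$ and $x\in\operatorname{supp}\mu$ let $\nabla f(\mu,x)\in\mathbb R^d$ be the vector with coordinates $\lim_{\eta\to0}\frac1\eta\bigl(f(\mu-\delta_x+\delta_{x+\eta\mathbf e_j})-f(\mu)\bigr)$, $1\le j\le d$. Let $H^1_0$ be the completion of $\{f\in C_c^\infty:\|f\|_{H^1}<\infty\}$ for the norm $\|f\|_{H^1}=\bigl(\mathbb E_\rho[f^2]+\mathbb E_\rho[\int_{\mathbb R^d}|\nabla f(\mu,x)|^2\,d\mu(x)]\bigr)^{1/2}$. An element $f$ of $H^1_0$ has a gradient $\nabla f$, namely the limit of $\nabla f_n$ in the $L^2$ space of the measure $d\mu(x)\,d\mathbb P_\rho(\mu)$ along a sequence $f_n\in C_c^\infty$ that converges to $f$ in $H^1_0$. For Borel $U\subset\mathbb R^d$ put $\mathcal E_U(f)=\mathbb E_\rho\bigl[\int_U|\nabla f(\mu,x)|^2\,d\mu(x)\bigr]$. **Proposition (Perturbation).** There is a constant $C(d)\in(0,\infty)$, depending only on $d$, such that the following holds for every $\rho>0$. Let $u\in C_c^\infty$ be $\mathcal F_{Q_{l_u}}$-measurable, where $l_u\ge0$,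 let $k\ge0$ and $l_k=l_u+2k$. Then for every $h\in\mathbb R^d$ with $|h|\le k$ and every $g\ge0$ with $\mathbb E_\rho[g]=1$ and $\sqrt g\in H^1_0$, the function $g\,(u-\tau_hu)$ is integrable and $$\bigl(\mathbb E_\rho[g\,(u-\tau_hu)]\bigr)^2\le C(d)\,\bigl(l_k\|u\|_{L^\infty}\bigr)^2\,\mathcal E_{Q_{l_k}}(\sqrt g),$$ where $\|u\|_{L^\infty}$ is the essential supremum of $|u|$ under $\mathbb P_\rho$. -/

import Mathlib

open MeasureTheory Filter Topology
open scoped ENNReal NNReal ContDiff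

namespace PoissonConfig

/-- The Euclidean space of dimension `d`. -/
abbrev Space (d : ℕ) := EuclideanSpace ℝ (Fin d)

/-- The closed cube of edge length `s` centred at the origin. -/
def cube (d : ℕ) (s : ℝ) : Set (Space d) := {x | ∀ i, x i ∈ Set.Icc (-(s / 2)) (s / 2)}

/-- A point measure: a locally finite (i.e. Radon) measure on `ℝᵈ` that is a finite or countable
sum of Dirac masses. Multiple points are allowed. -/
def IsPointMeasure {d : ℕ} (μ : Measure (Space d)) : Prop :=
  IsLocallyFiniteMeasure μ ∧
    ∃ (ι : Type) (_ : Countable ι) (p : ι → Space d), μ = Measure.sum fun i => Measure.dirac (p i)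

/-- The continuum configuration space: all locally finite point measures on `ℝᵈ`. -/
def Config (d : ℕ) : Type := {μ : Measure (Space d) // IsPointMeasure μ}

/-- The `σ`-algebra of the observables in `U`: the smallest one for which `μ ↦ μ V` is measurable
for every Borel set `V ⊆ U`. -/
@[reducible] def sigmaAlg {d : ℕ} (U : Set (Space d)) : MeasurableSpace (Config d) :=
  ⨆ (V : Set (Space d)) (_ : MeasurableSet V) (_ : V ⊆ U),
    MeasurableSpace.comap (fun μ : Config d => μ.1 V) inferInstance

/-- The configuration space carries the `σ`-algebra generated by all `μ ↦ μ V`, `V` Borel. -/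
instance instMeasurableSpaceConfig {d : ℕ} : MeasurableSpace (Config d) := sigmaAlg Set.univ

theorem IsPointMeasure.add {d : ℕ} {μ ν : Measure (Space d)} (hμ : IsPointMeasure μ)
    (hν : IsPointMeasure ν) : IsPointMeasure (μ + ν) := by
  obtain ⟨h1, ι, _, p, rfl⟩ := hμ
  obtain ⟨h2, κ, _, q, rfl⟩ := hν
  refine ⟨⟨fun x => ?_⟩, ι ⊕ κ, inferInstance, Sum.elim p q, ?_⟩
  · obtain ⟨s, hs, hs'⟩ := h1.finiteAtNhds x
    obtain ⟨t, ht, ht'⟩ := h2.finiteAtNhds x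
    refine ⟨s ∩ t, inter_mem hs ht, ?_⟩
    rw [Measure.add_apply]
    exact ENNReal.add_lt_top.2 ⟨(measure_mono Set.inter_subset_left).trans_lt hs',
      (measure_mono Set.inter_subset_right).trans_lt ht'⟩
  · ext s hs
    rw [Measure.add_apply, Measure.sum_apply _ hs, Measure.sum_apply _ hs, Measure.sum_apply _ hs,
      ENNReal.summable.tsum_sum (f := fun i => Measure.dirac (Sum.elim p q i) s) ENNReal.summable]
    rfl

theorem IsPointMeasure.sum_dirac {d N : ℕ} (x : Fin N → Space d) :
    IsPointMeasure (∑ i, Measure.dirac (x i)) := by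
  refine ⟨inferInstance, Fin N, inferInstance, x, ?_⟩
  rw [Measure.sum_fintype]

theorem IsPointMeasure.dirac {d : ℕ} (y : Space d) : IsPointMeasure (Measure.dirac y) := by
  simpa using IsPointMeasure.sum_dirac (fun _ : Fin 1 => y)

theorem IsPointMeasure.translate {d : ℕ} {μ : Measure (Space d)} (hμ : IsPointMeasure μ)
    (h : Space d) : IsPointMeasure (μ.map fun x => x + h) := by
  obtain ⟨h1, ι, _, p, hp⟩ := hμ
  refine ⟨⟨fun x => ?_⟩, ι, inferInstance, fun i => p i + h, ?_⟩
  · obtain ⟨s, hs, hs'⟩ := h1.finiteAtNhds (x - h)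
    refine ⟨(fun y => y - h) ⁻¹' s, ?_, ?_⟩
    · exact (continuous_id.sub continuous_const).continuousAt.preimage_mem_nhds hs
    · have : MeasurableEmbedding (fun x : Space d => x + h) := measurableEmbedding_addRight h
      rw [this.map_apply]
      simpa [Set.preimage_preimage] using hs'
  · subst hp
    rw [Measure.map_sum (by fun_prop)]
    congr 1
    ext1 i
    exact Measure.map_dirac' (by fun_prop) (p i)

theorem IsPointMeasure.erase {d : ℕ} {μ : Measure (Space d)} (hμ : IsPointMeasure μ)
    (x : Space d) : IsPointMeasure (μ.restrict {x}ᶜ + (μ {x} - 1) • Measure.dirac x) := by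
  obtain ⟨h1, ι, _, p, hp⟩ := hμ
  refine IsPointMeasure.add ⟨inferInstance, {i // p i ≠ x}, inferInstance, fun i => p i, ?_⟩ ?_
  · ext s hs
    rw [hp, Measure.restrict_apply hs, Measure.sum_apply _ (hs.inter (measurableSet_singleton x).compl),
      Measure.sum_apply _ hs, ← tsum_subtype_eq_of_support_subset (s := {i | p i ≠ x})]
    · refine tsum_congr fun i => ?_
      have hi : p i ≠ x := i.2
      rw [Measure.dirac_apply' _ (hs.inter (measurableSet_singleton x).compl),
        Measure.dirac_apply' _ hs]
      by_cases h : p i ∈ s <;> simp [Set.indicator, h, hi]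
    · intro i hi h
      apply hi
      show Measure.dirac (p i) (s ∩ {x}ᶜ) = 0
      rw [Measure.dirac_apply' _ (hs.inter (measurableSet_singleton x).compl)]
      simp [h]
  · have hx : μ {x} = ({i | p i = x} : Set ι).encard := by
      rw [hp, Measure.sum_apply _ (measurableSet_singleton x), ← ENNReal.tsum_set_one,
        tsum_subtype {i | p i = x} (fun _ => (1 : ℝ≥0∞))]
      refine tsum_congr fun i => ?_
      rw [Measure.dirac_apply' _ (measurableSet_singleton x)]
      simp [Set.indicator]
    have hfin : μ {x} ≠ ⊤ := isCompact_singleton.measure_lt_top.ne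
    have hf : ({i | p i = x} : Set ι).Finite := by
      rw [← Set.encard_ne_top_iff]
      intro h
      rw [hx, h] at hfin
      simp at hfin
    obtain ⟨n, hn⟩ : ∃ n : ℕ, μ {x} - 1 = n := by
      refine ⟨({i | p i = x} : Set ι).ncard - 1, ?_⟩
      rw [hx, ← hf.cast_ncard_eq]
      push_cast
      simp
    have := IsPointMeasure.sum_dirac (fun _ : Fin n => x)
    rw [hn]
    convert this using 1
    simp [Nat.cast_smul_eq_nsmul]

/-- The finite configuration `∑ᵢ δ_{xᵢ}`. -/
noncomputable def ofPoints {d N : ℕ} (x : Fin N → Space d) : Config d :=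
  ⟨∑ i, Measure.dirac (x i), IsPointMeasure.sum_dirac x⟩

/-- The transport of a configuration: every particle is shifted by `h`. -/
noncomputable def translate {d : ℕ} (h : Space d) (μ : Config d) : Config d :=
  ⟨μ.1.map fun x => x + h, μ.2.translate h⟩

/-- The transport of a function of the configuration, `(τ_h f)(μ) = f (τ_{-h} μ)`. -/
noncomputable def translateFun {d : ℕ} (h : Space d) (f : Config d → ℝ) : Config d → ℝ :=
  fun μ => f (translate (-h) μ)

/-- The configuration `μ - δ_x + δ_y`, where one particle of `μ` at `x` is moved to `y`
(meaningful when `μ` has a particle at `x`). -/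
noncomputable def move {d : ℕ} (μ : Config d) (x y : Space d) : Config d :=
  ⟨(μ.1.restrict {x}ᶜ + (μ.1 {x} - 1) • Measure.dirac x) + Measure.dirac y,
    (μ.2.erase x).add (IsPointMeasure.dirac y)⟩

/-- The gradient of `f` with respect to the position of a particle of `μ` at `x`; its `k`-th
coordinate is the derivative at `h = 0` of `h ↦ f (μ - δ_x + δ_{x + h eₖ})`. -/
noncomputable def grad {d : ℕ} (f : Config d → ℝ) (μ : Config d) (x : Space d) : Space d :=
  WithLp.toLp 2 fun k =>
    deriv (fun h : ℝ => f (move μ x (x + h • EuclideanSpace.single k (1 : ℝ)))) 0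

/-- `P` is the law of the Poisson point process on `ℝᵈ` of density `ρ`, given by its finite-volume
laws: for each bounded Borel set `U`, the number of particles in `U` is Poisson with parameter
`ρ|U|`, and given that there are `N` of them they are independent and uniform in `U`. Thus the
weight `e^{-ρ|U|} (ρ|U|)^N / N!` and the average over `U^N` combine to
`e^{-ρ|U|} ρ^N / N!` times the integral over `U^N`. -/
def IsPoisson {d : ℕ} (ρ : ℝ) (P : Measure (Config d)) : Prop :=
  ∀ U : Set (Space d), MeasurableSet U → Bornology.IsBounded U →
    ∀ F : Config d → ℝ≥0∞, Measurable[sigmaAlg U] F →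
      ∫⁻ μ, F μ ∂P =
        ∑' N : ℕ, ENNReal.ofReal (Real.exp (-(ρ * (volume U).toReal)) * ρ ^ N / N.factorial) *
          ∫⁻ x in Set.univ.pi fun _ : Fin N => U, F (ofPoints x)

/-- The class `C_c^∞` of smooth local functions on the configuration space: bounded functions
that depend only on the configuration in some compact set and that are, for each `N`, smooth
functions of the positions of the particles on the set of configurations of `N` particles. -/
structure IsSmoothLocal {d : ℕ} (f : Config d → ℝ) : Prop where
  local_meas : ∃ V : Set (Space d), IsCompact V ∧ Measurable[sigmaAlg V] f
  smooth : ∀ N : ℕ, ContDiff ℝ ∞ fun x : Fin N → Space d => f (ofPoints x)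
  bounded : ∃ M : ℝ, ∀ μ, |f μ| ≤ M

/-- `E_ρ[∫_U |G(μ, x)|² dμ(x)]` for a field `G`. -/
noncomputable def energyOn {d : ℕ} (P : Measure (Config d)) (U : Set (Space d))
    (G : Config d → Space d → Space d) : ℝ≥0∞ :=
  ∫⁻ μ, ∫⁻ x in U, ‖G μ x‖ₑ ^ 2 ∂μ.1 ∂P

/-- `f` belongs to `H¹₀`, with gradient `G`. The space `H¹₀` is the completion of the functions of
class `C_c^∞` with finite `H¹` norm, for the norm
`(E_ρ[f²] + E_ρ[∫ |∇f|² dμ])^{1/2}`; equivalently it is the closure of the set of pairs `(f, ∇f)`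
in the product of `L²(P)` and the `L²` space of fields. -/
structure HasH10Gradient {d : ℕ} (P : Measure (Config d)) (f : Config d → ℝ)
    (G : Config d → Space d → Space d) : Prop where
  memLp : MemLp f 2 P
  measurable_grad : Measurable fun p : Config d × Space d => G p.1 p.2
  approx : ∃ φ : ℕ → Config d → ℝ,
    (∀ n, IsSmoothLocal (φ n) ∧ MemLp (φ n) 2 P ∧ energyOn P Set.univ (grad (φ n)) < ⊤) ∧
    Tendsto (fun n => eLpNorm (φ n - f) 2 P) atTop (𝓝 0) ∧
    Tendsto (fun n => energyOn P Set.univ fun μ x => grad (φ n) μ x - G μ x) atTop (𝓝 0)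

end PoissonConfig

namespace PoissonConfig

/-! ### Local observables, restriction and translation of configurations. -/

variable {d : ℕ}

/-! Let `Q` be the cube of edge `l + 2 * k` and `w = u - τ_h u`. Since `|h| ≤ k`, `w` depends only
on the particles in `Q`. Once the number of these particles is fixed they are independent and
uniform in `Q`, and translation invariance of volume gives `u` and `τ_h u` the same law
(`map_cellLaw_eq`). Hence `w` has mean zero given the number of particles in `Q` and the particles
outside, and `E[f² w]` for `f = √g` only sees how `f` fluctuates when the particles of `Q` are
resampled.

Write `f'` for `f` after that resampling. Then `E[f² w] = E[(f² - f'²) w]`, and Young's inequality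
bounds `|f² - f'²|` by `λ |f - f'|² + λ⁻¹ (f² + f'²)` (`enorm_integral_sq_mul_le`). The mean of `|f
- f'|²` is controlled by the gradient: Efron–Stein tensorization (`resampleEnergy_le_sum`) reduces
it to one particle and then to one coordinate, where it is the Poincaré inequality on an interval.
The constant is the square of the edge length, whatever the number of particles.

To make the conditioning concrete, the Poisson law in a large cube `U ⊇ Q` is written as a countable
mixture of product laws `cellLaw`, indexed by the number `N` of labelled particles and the set `S`
of labels in `Q` (`IsPoisson.map_restrictTo`). For fixed `λ` the bound on a cell is additive in the
energy and in the mass of `f²`, so it can be summed over the cells with the same `λ`. Approximation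
by smooth local functions extends it to `H¹₀`, and the choice of `λ` at the very end produces the
square root hidden in the statement (`sq_le_of_forall_pos`). -/

theorem sigmaAlg_mono {U V : Set (Space d)} (h : U ⊆ V) : sigmaAlg U ≤ sigmaAlg V :=
  iSup_mono fun _ => iSup_mono fun _ => iSup_le fun hU => le_iSup_of_le (hU.trans h) le_rfl

theorem measurable_apply {U V : Set (Space d)} (hV : MeasurableSet V) (h : V ⊆ U) :
    Measurable[sigmaAlg U] fun μ : Config d => μ.1 V :=
  Measurable.mono (comap_measurable _)
    (le_iSup_of_le V (le_iSup_of_le hV (le_iSup_of_le h le_rfl))) le_rfl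

theorem measurable_sigmaAlg_of_apply {α : Type*} {m : MeasurableSpace α} {U : Set (Space d)}
    {f : α → Config d}
    (h : ∀ V, MeasurableSet V → V ⊆ U → Measurable fun a => (f a).1 V) :
    Measurable[m, sigmaAlg U] f := by
  refine Measurable.of_comap_le ?_
  simp only [sigmaAlg, MeasurableSpace.comap_iSup, MeasurableSpace.comap_comp]
  exact iSup_le fun V => iSup_le fun hV => iSup_le fun hU => (h V hV hU).comap_le

theorem measurable_of_sigmaAlg {β : Type*} [MeasurableSpace β] {U : Set (Space d)}
    {f : Config d → β} (h : Measurable[sigmaAlg U] f) : Measurable f :=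
  h.mono (sigmaAlg_mono (Set.subset_univ U)) le_rfl

/-- An observable in `U` takes the same value at configurations that agree in `U`. -/
theorem eq_of_agree {β : Type*} [MeasurableSpace β] [MeasurableSingletonClass β]
    {U : Set (Space d)} {f : Config d → β} (hf : Measurable[sigmaAlg U] f) {μ ν : Config d}
    (h : ∀ V, MeasurableSet V → V ⊆ U → μ.1 V = ν.1 V) : f μ = f ν := by
  -- `r` records all observable masses, with value `0` at sets that are not observable. Every set of
  -- `sigmaAlg U` is a preimage under `r`, so it cannot separate configurations with the same `r`.
  let r : Config d → Set (Space d) → ℝ≥0∞ := fun μ V => ⨆ (_ : MeasurableSet V ∧ V ⊆ U), μ.1 V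
  have hr : r μ = r ν := by
    ext V
    exact iSup_congr fun hV => h V hV.1 hV.2
  have hle : sigmaAlg U ≤ MeasurableSpace.comap r ⊤ := by
    refine iSup_le fun V => iSup_le fun hV => iSup_le fun hU => ?_
    rintro _ ⟨s, hs, rfl⟩
    refine ⟨{q | q V ∈ s}, trivial, ?_⟩
    ext μ
    simp [r, hV, hU]
  obtain ⟨s, -, hs⟩ := hle _ (hf (measurableSet_singleton (f μ)))
  have h1 : μ ∈ r ⁻¹' s := by rw [hs]; rfl
  have h2 : ν ∈ r ⁻¹' s := by
    rw [Set.mem_preimage, ← hr]; exact h1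
  rw [hs] at h2
  exact h2.symm

theorem IsPointMeasure.restrict {μ : Measure (Space d)} (hμ : IsPointMeasure μ)
    {U : Set (Space d)} (hU : MeasurableSet U) : IsPointMeasure (μ.restrict U) := by
  obtain ⟨h1, ι, _, p, rfl⟩ := hμ
  refine ⟨inferInstance, {i // p i ∈ U}, inferInstance, fun i => p i, ?_⟩
  ext s hs
  rw [Measure.restrict_apply hs, Measure.sum_apply _ (hs.inter hU), Measure.sum_apply _ hs,
    ← tsum_subtype_eq_of_support_subset (s := {i | p i ∈ U})]
  · refine tsum_congr fun i => ?_
    have hi : p i ∈ U := i.2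
    rw [Measure.dirac_apply' _ (hs.inter hU), Measure.dirac_apply' _ hs]
    by_cases h : p i ∈ s <;> simp [h, hi]
  · intro i hi
    by_contra h
    apply hi
    have h' : p i ∉ U := h
    show Measure.dirac (p i) (s ∩ U) = 0
    rw [Measure.dirac_apply' _ (hs.inter hU)]
    simp [h']

/-- The configuration of the particles of `μ` in `U`. -/
noncomputable def restrictTo {U : Set (Space d)} (hU : MeasurableSet U) (μ : Config d) : Config d :=
  ⟨μ.1.restrict U, μ.2.restrict hU⟩

theorem restrictTo_apply {U V : Set (Space d)} (hU : MeasurableSet U) (h : V ⊆ U) (μ : Config d) :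
    (restrictTo hU μ).1 V = μ.1 V := by
  simp [restrictTo, Measure.restrict_eq_self _ h]

theorem measurable_restrictTo {U : Set (Space d)} (hU : MeasurableSet U) :
    Measurable[sigmaAlg U, sigmaAlg Set.univ] (restrictTo hU) := by
  refine measurable_sigmaAlg_of_apply fun V hV _ => ?_
  simp only [restrictTo, Measure.restrict_apply hV]
  exact measurable_apply (hV.inter hU) Set.inter_subset_right

theorem ofPoints_apply {N : ℕ} (x : Fin N → Space d) {V : Set (Space d)} (hV : MeasurableSet V) :
    (ofPoints x).1 V = ∑ i, V.indicator 1 (x i) := by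
  simp [ofPoints, Measure.dirac_apply' _ hV]

theorem measurable_ofPoints {N : ℕ} :
    Measurable (ofPoints : (Fin N → Space d) → Config d) := by
  refine measurable_sigmaAlg_of_apply fun V hV _ => ?_
  simp only [ofPoints_apply _ hV]
  exact Finset.measurable_sum _ fun i _ =>
    (measurable_one.indicator hV).comp (measurable_pi_apply i)

theorem translate_apply (h : Space d) (μ : Config d) {V : Set (Space d)} (hV : MeasurableSet V) :
    (translate h μ).1 V = μ.1 ((fun x => x + h) ⁻¹' V) := by
  simp [translate, Measure.map_apply (measurable_add_const h) hV]

theorem measurable_translate (h : Space d) : Measurable (translate h : Config d → Config d) := by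
  refine measurable_sigmaAlg_of_apply fun V hV _ => ?_
  simp only [translate_apply h _ hV]
  exact measurable_apply (measurable_add_const h hV) (Set.subset_univ _)

theorem translate_ofPoints {N : ℕ} (h : Space d) (x : Fin N → Space d) :
    translate h (ofPoints x) = ofPoints fun i => x i + h := by
  refine Subtype.ext (Measure.ext fun V hV => ?_)
  rw [translate_apply h _ hV, ofPoints_apply _ hV, ofPoints_apply _ (measurable_add_const h hV)]
  rfl

theorem translate_zero (μ : Config d) : translate 0 μ = μ := by
  refine Subtype.ext ?_
  simp [translate]

/-- Integration of a jointly measurable function against the particles in a bounded set is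
measurable in the configuration. -/
theorem measurable_lintegral_restrict {α : Type*} [MeasurableSpace α] {κ : α → Config d}
    {U : Set (Space d)} (hU : MeasurableSet U) (hb : Bornology.IsBounded U)
    (hκ : Measurable[_, sigmaAlg U] κ) {F : α × Space d → ℝ≥0∞} (hF : Measurable F) :
    Measurable fun a => ∫⁻ x in U, F (a, x) ∂(κ a).1 := by
  have hfin : ∀ a, (κ a).1 U < ⊤ := fun a => by
    have := (κ a).2.1
    exact hb.measure_lt_top
  have hmU : Measurable fun a => (κ a).1 U :=
    (measurable_apply (U := U) hU subset_rfl).comp hκ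
  let K : ProbabilityTheory.Kernel α (Space d) :=
    ⟨fun a => (κ a).1.restrict U, Measure.measurable_of_measurable_coe _ fun V hV => by
      simp only [Measure.restrict_apply hV]
      exact (measurable_apply (U := U) (hV.inter hU) Set.inter_subset_right).comp hκ⟩
  -- The masses `κ a U` are finite but not uniformly bounded. Slicing `α` by their integer part
  -- turns `K` into a countable sum of finite kernels, hence an s-finite kernel.
  let A : ℕ → Set α := fun n => {a | ⌊((κ a).1 U).toNNReal⌋₊ = n}
  have hA : ∀ n, MeasurableSet (A n) := fun n =>
    (Nat.measurable_floor.comp hmU.ennreal_toNNReal) (measurableSet_singleton n)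
  classical
  let Kn : ℕ → ProbabilityTheory.Kernel α (Space d) := fun n =>
    ProbabilityTheory.Kernel.piecewise (hA n) K 0
  have : ∀ n, ProbabilityTheory.IsFiniteKernel (Kn n) := fun n => by
    refine ⟨⟨n + 1, by finiteness, fun a => ?_⟩⟩
    rw [ProbabilityTheory.Kernel.piecewise_apply]
    split_ifs with h
    · have h' : ⌊((κ a).1 U).toNNReal⌋₊ = n := h
      have h2 := Nat.lt_floor_add_one ((κ a).1 U).toNNReal
      rw [h'] at h2
      show (κ a).1.restrict U Set.univ ≤ _
      rw [Measure.restrict_apply_univ, ← ENNReal.coe_toNNReal (hfin a).ne]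
      exact_mod_cast h2.le
    · simp
  have hK : K = ProbabilityTheory.Kernel.sum Kn := by
    ext a s hs
    rw [ProbabilityTheory.Kernel.sum_apply' _ _ hs,
      tsum_eq_single ⌊((κ a).1 U).toNNReal⌋₊]
    · rw [ProbabilityTheory.Kernel.piecewise_apply, if_pos (show a ∈ A _ from rfl)]
    · intro n hn
      rw [ProbabilityTheory.Kernel.piecewise_apply,
        if_neg (show a ∉ A n from fun h => hn (Eq.symm h))]
      simp
  have : ProbabilityTheory.IsSFiniteKernel K := ⟨Kn, this, hK⟩
  exact Measurable.lintegral_kernel_prod_right' (κ := K) hF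

/-- The particles of a configuration in a compact set are finitely many. -/
theorem exists_ofPoints_agree {V : Set (Space d)} (hV : IsCompact V) (μ : Config d) :
    ∃ (N : ℕ) (x : Fin N → Space d),
      ∀ B, MeasurableSet B → B ⊆ V → μ.1 B = (ofPoints x).1 B := by
  obtain ⟨μ, h1, ι, _, p, hp⟩ := μ
  have hVm := hV.measurableSet
  have hcard : ∀ B, MeasurableSet B → μ B = ({i | p i ∈ B} : Set ι).encard := by
    intro B hB
    rw [hp, Measure.sum_apply _ hB, ← ENNReal.tsum_set_one,
      tsum_subtype {i | p i ∈ B} (fun _ => (1 : ℝ≥0∞))]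
    refine tsum_congr fun i => ?_
    rw [Measure.dirac_apply' _ hB]
    simp [Set.indicator]
  have hf : ({i | p i ∈ V} : Set ι).Finite := by
    rw [← Set.encard_ne_top_iff]
    intro h
    have hfin : μ V ≠ ⊤ := hV.measure_lt_top.ne
    rw [hcard V hVm, h] at hfin
    simp at hfin
  have := hf.fintype
  let e := Fintype.equivFin {i | p i ∈ V}
  refine ⟨_, fun j => p (e.symm j), fun B hB hBV => ?_⟩
  rw [ofPoints_apply _ hB]
  have h2 : ∑ j, B.indicator (1 : Space d → ℝ≥0∞) (p (e.symm j)) =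
      ∑ i : {i | p i ∈ V}, B.indicator (1 : Space d → ℝ≥0∞) (p i) :=
    e.symm.sum_comp fun i : {i | p i ∈ V} => B.indicator (1 : Space d → ℝ≥0∞) (p i)
  rw [h2]
  show μ B = _
  rw [hp, Measure.sum_apply _ hB, ← tsum_fintype (L := .unconditional _),
    ← tsum_subtype_eq_of_support_subset (s := {i | p i ∈ V})]
  · exact tsum_congr fun i => Measure.dirac_apply' _ hB
  · intro i hi
    by_contra h
    apply hi
    show Measure.dirac (p i) B = 0
    rw [Measure.dirac_apply' _ hB]
    exact Set.indicator_of_notMem (fun h' => h (hBV h')) _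

/-! ### Resampling of coordinates and Efron–Stein tensorization. -/

theorem enorm_sq_eq_ofReal (r : ℝ) : ‖r‖ₑ ^ 2 = ENNReal.ofReal (r ^ 2) := by
  rw [Real.enorm_eq_ofReal_abs, ← ENNReal.ofReal_pow (abs_nonneg r), sq_abs]

theorem measurable_finsetPiecewise {ι X : Type*} [DecidableEq ι] [MeasurableSpace X]
    (S : Finset ι) :
    Measurable fun p : (ι → X) × (ι → X) => S.piecewise p.1 p.2 := by
  refine measurable_pi_lambda _ fun i => ?_
  by_cases h : i ∈ S
  · simp only [Finset.piecewise, h, if_true]; fun_prop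
  · simp only [Finset.piecewise, h, if_false]; fun_prop

theorem singleton_piecewise_eq_update {ι X : Type*} [DecidableEq ι] (i : ι) (x y : ι → X) :
    ({i} : Finset ι).piecewise y x = Function.update x i (y i) := by
  funext j
  by_cases h : j = i
  · subst h; simp [Finset.piecewise]
  · simp [Finset.piecewise, h]

section Resampling

variable {ι X : Type*} [Fintype ι] [DecidableEq ι] [MeasurableSpace X]
  (σ : ι → Measure X) [∀ i, IsProbabilityMeasure (σ i)]

/-- Exchanging the coordinates in `S` of two independent samples preserves their law. -/
theorem measurePreserving_exchange (S : Finset ι) :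
    MeasurePreserving
      (fun p : (ι → X) × (ι → X) => (S.piecewise p.2 p.1, S.piecewise p.1 p.2))
      ((Measure.pi σ).prod (Measure.pi σ)) ((Measure.pi σ).prod (Measure.pi σ)) := by
  have h1 := measurePreserving_arrowProdEquivProdArrow X X ι σ σ
  have h2 : MeasurePreserving
      (fun (q : ι → X × X) (i : ι) => (if i ∈ S then Prod.swap (q i) else q i))
      (.pi fun i => (σ i).prod (σ i)) (.pi fun i => (σ i).prod (σ i)) := by
    refine measurePreserving_pi _ _ (f := fun i q => if i ∈ S then Prod.swap q else q) fun i => ?_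
    by_cases h : i ∈ S
    · simp only [h, if_true]; exact Measure.measurePreserving_swap
    · simp only [h, if_false]; exact MeasurePreserving.id _
  convert h1.comp (h2.comp h1.symm) using 1
  funext p
  refine Prod.ext (funext fun i => ?_) (funext fun i => ?_) <;>
  by_cases h : i ∈ S <;>
  simp [Finset.piecewise, h, MeasurableEquiv.arrowProdEquivProdArrow,
    Equiv.arrowProdEquivProdArrow]

/-- The mean square oscillation of `ψ` when the coordinates in `S` are resampled. -/
noncomputable def resampleEnergy (S : Finset ι) (ψ : (ι → X) → ℝ) : ℝ≥0∞ :=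
  ∫⁻ p : (ι → X) × (ι → X), ‖ψ p.1 - ψ (S.piecewise p.2 p.1)‖ₑ ^ 2
    ∂((Measure.pi σ).prod (Measure.pi σ))

/-- In a quadrilateral the squared diagonals sum to at most the squared sides; the defect is `(a + b
- c - e) ^ 2`. -/
theorem enorm_sq_quadrilateral (a b c e : ℝ) :
    ‖a - b‖ₑ ^ 2 + ‖c - e‖ₑ ^ 2 ≤
      (‖a - e‖ₑ ^ 2 + ‖c - b‖ₑ ^ 2) + (‖a - c‖ₑ ^ 2 + ‖e - b‖ₑ ^ 2) := by
  simp only [enorm_sq_eq_ofReal]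
  rw [← ENNReal.ofReal_add (by positivity) (by positivity),
    ← ENNReal.ofReal_add (by positivity) (by positivity),
    ← ENNReal.ofReal_add (by positivity) (by positivity),
    ← ENNReal.ofReal_add (by positivity) (by positivity)]
  exact ENNReal.ofReal_le_ofReal (by nlinarith [sq_nonneg (a + b - c - e)])

variable {ψ : (ι → X) → ℝ}

/-- The four points `x`, `x` resampled at `i`, at `S`, and at both, form a quadrilateral. Both
diagonals resample `insert i S` and opposite sides resample the same set, up to an exchange of
coordinates that preserves the law. Integrating the quadrilateral inequality therefore gives twice
the claim. -/
theorem resampleEnergy_insert_le (hψ : Measurable ψ) {i : ι} {S : Finset ι} (hi : i ∉ S) :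
    resampleEnergy σ (insert i S) ψ ≤ resampleEnergy σ {i} ψ + resampleEnergy σ S ψ := by
  set π := (Measure.pi σ).prod (Measure.pi σ)
  let H : Finset ι → (ι → X) × (ι → X) → ℝ≥0∞ :=
    fun S p => ‖ψ p.1 - ψ (S.piecewise p.2 p.1)‖ₑ ^ 2
  let T : Finset ι → (ι → X) × (ι → X) → (ι → X) × (ι → X) :=
    fun S p => (S.piecewise p.2 p.1, S.piecewise p.1 p.2)
  have hH : ∀ S, Measurable (H S) := fun S =>
    ((hψ.comp measurable_fst).sub
      (hψ.comp ((measurable_finsetPiecewise S).comp measurable_swap))).enorm.pow_const 2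
  have hT : ∀ S, MeasurePreserving (T S) π π := fun S => measurePreserving_exchange σ S
  have key : ∀ p, H (insert i S) p + H (insert i S) (T S p) ≤
      (H {i} p + H {i} (T S p)) + (H S p + H S (T {i} p)) := by
    rintro ⟨x, y⟩
    have e1 : (insert i S).piecewise (S.piecewise x y) (S.piecewise y x) =
        ({i} : Finset ι).piecewise y x := by
      funext j
      by_cases hj : j = i
      · subst hj; simp [Finset.piecewise, hi]
      · by_cases hS : j ∈ S <;> simp [Finset.piecewise, hj, hS]
    have e2 : ({i} : Finset ι).piecewise (S.piecewise x y) (S.piecewise y x) =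
        (insert i S).piecewise y x := by
      funext j
      by_cases hj : j = i
      · subst hj; simp [Finset.piecewise, hi]
      · by_cases hS : j ∈ S <;> simp [Finset.piecewise, hj, hS]
    have e3 : S.piecewise (({i} : Finset ι).piecewise x y) (({i} : Finset ι).piecewise y x) =
        (insert i S).piecewise y x := by
      funext j
      by_cases hj : j = i
      · subst hj; simp [Finset.piecewise, hi]
      · by_cases hS : j ∈ S <;> simp [Finset.piecewise, hj, hS]
    simp only [H, T, e1, e2, e3]
    exact enorm_sq_quadrilateral _ _ _ _
  have hint := lintegral_mono (μ := π) key
  rw [lintegral_add_left (hH _), lintegral_add_left (show Measurable fun p => H {i} p + H {i} (T S p) from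
      (hH _).add ((hH _).comp (hT _).measurable)), lintegral_add_left (hH _),
    lintegral_add_left (hH _), (hT S).lintegral_comp (hH _),
    (hT S).lintegral_comp (hH _), (hT {i}).lintegral_comp (hH _), ← two_mul, ← two_mul, ← two_mul,
    ← mul_add] at hint
  exact (ENNReal.mul_le_mul_iff_right two_ne_zero ENNReal.ofNat_ne_top).1 hint

/-- Tensorization (Efron–Stein). -/
theorem resampleEnergy_le_sum (hψ : Measurable ψ) (S : Finset ι) :
    resampleEnergy σ S ψ ≤ ∑ i ∈ S, resampleEnergy σ {i} ψ := by
  induction S using Finset.induction_on with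
  | empty => simp [resampleEnergy]
  | insert i S hi ih =>
    rw [Finset.sum_insert hi]
    exact (resampleEnergy_insert_le σ hψ hi).trans (by gcongr)

theorem lintegral_update {f : (ι → X) → ℝ≥0∞} (hf : Measurable f) (i : ι) :
    ∫⁻ x, ∫⁻ s, f (Function.update x i s) ∂σ i ∂Measure.pi σ = ∫⁻ x, f x ∂Measure.pi σ := by
  have h1 : ∀ x, ∫⁻ s, f (Function.update x i s) ∂σ i =
      ∫⁻ y, f (Function.update x i (y i)) ∂Measure.pi σ := fun x =>
    ((measurePreserving_eval σ i).lintegral_comp (hf.comp (measurable_update x))).symm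
  simp_rw [h1, ← singleton_piecewise_eq_update]
  rw [lintegral_lintegral (f := fun x y => f (({i} : Finset ι).piecewise y x))
    (hf.comp ((measurable_finsetPiecewise {i}).comp measurable_swap)).aemeasurable]
  have h2 := (measurePreserving_exchange σ {i}).lintegral_comp (hf.comp measurable_fst)
  simp only [Function.comp_def] at h2
  rw [h2]
  exact (measurePreserving_fst (μ := Measure.pi σ) (ν := Measure.pi σ)).lintegral_comp hf

/-- Passes from an inequality on each fibre, with the other coordinates frozen, to the product law.
The two variables `s`, `t` are the new value of coordinate `i` and its old one, the latter averaged
separately through `lintegral_update`. -/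
theorem resampleEnergy_singleton_le (hψ : Measurable ψ) {i : ι} {e : (ι → X) → ℝ≥0∞}
    (he : Measurable e) {c : ℝ≥0∞} (hc : c ≠ ⊤)
    (h : ∀ x, ∫⁻ s, ∫⁻ t, ‖ψ (Function.update x i s) - ψ (Function.update x i t)‖ₑ ^ 2 ∂σ i ∂σ i ≤
      c * ∫⁻ s, e (Function.update x i s) ∂σ i) :
    resampleEnergy σ {i} ψ ≤ c * ∫⁻ x, e x ∂Measure.pi σ := by
  have hm : Measurable fun p : (ι → X) × X => ‖ψ p.1 - ψ (Function.update p.1 i p.2)‖ₑ ^ 2 := by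
    refine ((hψ.comp measurable_fst).sub (hψ.comp ?_)).enorm.pow_const 2
    exact measurable_update'
  let K : (ι → X) → ℝ≥0∞ := fun x => ∫⁻ t, ‖ψ x - ψ (Function.update x i t)‖ₑ ^ 2 ∂σ i
  have hK : Measurable K := Measurable.lintegral_prod_right' hm
  have h1 : resampleEnergy σ {i} ψ = ∫⁻ x, K x ∂Measure.pi σ := by
    unfold resampleEnergy
    have hm' : Measurable fun p : (ι → X) × (ι → X) =>
        ‖ψ p.1 - ψ (({i} : Finset ι).piecewise p.2 p.1)‖ₑ ^ 2 :=
      ((hψ.comp measurable_fst).sub (hψ.comp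
        ((measurable_finsetPiecewise {i}).comp measurable_swap))).enorm.pow_const 2
    rw [lintegral_prod _ hm'.aemeasurable]
    refine lintegral_congr fun x => ?_
    simp only [singleton_piecewise_eq_update]
    exact (measurePreserving_eval σ i).lintegral_comp (hm.comp (measurable_prodMk_left (x := x)))
  rw [h1, ← lintegral_update σ hK i, ← lintegral_update σ he i, ← lintegral_const_mul' _ _ hc]
  refine lintegral_mono fun x => ?_
  simpa only [K, Function.update_idem] using h x

end Resampling

/-! ### Poincaré inequalities on intervals, cubes and products of cubes. -/

theorem lintegral_lintegral_map {α β : Type*} [MeasurableSpace α] [MeasurableSpace β]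
    (μ : Measure α) [SFinite μ] {g : α → β} (hg : Measurable g) {H : β × β → ℝ≥0∞}
    (hH : Measurable H) :
    ∫⁻ s, ∫⁻ t, H (s, t) ∂μ.map g ∂μ.map g = ∫⁻ p, H (g p.1, g p.2) ∂μ.prod μ := by
  have h : Measurable fun p : α × α => H (g p.1, g p.2) :=
    hH.comp ((hg.comp measurable_fst).prodMk (hg.comp measurable_snd))
  rw [lintegral_map hH.lintegral_prod_right' hg, lintegral_prod _ h.aemeasurable]
  exact lintegral_congr fun x => lintegral_map (hH.comp measurable_prodMk_left) hg

theorem lintegral_sq_le {α : Type*} [MeasurableSpace α] (μ : Measure α) [IsProbabilityMeasure μ]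
    {f : α → ℝ≥0∞} (hf : Measurable f) : (∫⁻ x, f x ∂μ) ^ 2 ≤ ∫⁻ x, f x ^ 2 ∂μ := by
  have h := ENNReal.lintegral_mul_le_Lp_mul_Lq μ Real.HolderConjugate.two_two hf.aemeasurable
    (aemeasurable_const (b := (1 : ℝ≥0∞)))
  simp only [Pi.mul_apply, mul_one, ENNReal.one_rpow, lintegral_const, measure_univ] at h
  calc (∫⁻ x, f x ∂μ) ^ 2 ≤ ((∫⁻ x, f x ^ (2 : ℝ) ∂μ) ^ (1 / (2 : ℝ))) ^ 2 := by gcongr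
    _ = ∫⁻ x, f x ^ 2 ∂μ := by
      rw [← ENNReal.rpow_natCast, ← ENNReal.rpow_mul]
      norm_num

open ProbabilityTheory

theorem lintegral_cond {α : Type*} [MeasurableSpace α] (μ : Measure α) (s : Set α)
    (f : α → ℝ≥0∞) : ∫⁻ x, f x ∂(cond μ s) = (μ s)⁻¹ * ∫⁻ x in s, f x ∂μ := by
  rw [ProbabilityTheory.cond, lintegral_smul_measure, smul_eq_mul]

/-- The Poincaré inequality on an interval. -/
theorem poincare_interval {a b : ℝ} (hab : a < b) {f : ℝ → ℝ} (hf : ContDiff ℝ 1 f) :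
    ∫⁻ s, ∫⁻ t, ‖f s - f t‖ₑ ^ 2 ∂(cond volume (Set.Icc a b)) ∂(cond volume (Set.Icc a b)) ≤
      ENNReal.ofReal (b - a) ^ 2 * ∫⁻ s, ‖deriv f s‖ₑ ^ 2 ∂(cond volume (Set.Icc a b)) := by
  set I := Set.Icc a b
  have hv : volume I = ENNReal.ofReal (b - a) := Real.volume_Icc
  have hv0 : volume I ≠ 0 := by rw [hv]; simpa using hab
  have hvt : volume I ≠ ⊤ := by rw [hv]; exact ENNReal.ofReal_ne_top
  have : IsProbabilityMeasure (cond volume I) :=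
    cond_isProbabilityMeasure_of_finite hv0 hvt
  have hc : Continuous (deriv f) := hf.continuous_deriv le_rfl
  -- The bound already holds pointwise, by the fundamental theorem of calculus and Cauchy–Schwarz,
  -- so averaging over `s` and `t` costs nothing.
  have key : ∀ s ∈ I, ∀ t ∈ I, ‖f s - f t‖ₑ ^ 2 ≤
      ENNReal.ofReal (b - a) ^ 2 * ∫⁻ s, ‖deriv f s‖ₑ ^ 2 ∂(cond volume I) := by
    intro s hs t ht
    have h1 : f s - f t = ∫ r in t..s, deriv f r :=
      (intervalIntegral.integral_deriv_eq_sub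
        (fun r _ => (hf.differentiable one_ne_zero).differentiableAt)
        (hc.intervalIntegrable _ _)).symm
    have h2 : ‖f s - f t‖ₑ ≤ ∫⁻ r in I, ‖deriv f r‖ₑ := by
      rw [h1, ← ofReal_norm, intervalIntegral.norm_intervalIntegral_eq, ofReal_norm]
      refine (enorm_integral_le_lintegral_enorm _).trans (lintegral_mono_set ?_)
      exact Set.uIoc_subset_uIcc.trans (Set.uIcc_subset_Icc ht hs)
    have h3 : ∫⁻ r in I, ‖deriv f r‖ₑ =
        ENNReal.ofReal (b - a) * ∫⁻ r, ‖deriv f r‖ₑ ∂(cond volume I) := by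
      rw [lintegral_cond, ← hv, ← mul_assoc, ENNReal.mul_inv_cancel hv0 hvt, one_mul]
    calc ‖f s - f t‖ₑ ^ 2 ≤
        (ENNReal.ofReal (b - a) * ∫⁻ r, ‖deriv f r‖ₑ ∂(cond volume I)) ^ 2 := by
          rw [← h3]; gcongr
      _ ≤ _ := by
        rw [mul_pow]
        gcongr
        exact lintegral_sq_le _ hc.measurable.enorm
  have hmem : ∀ᵐ s ∂(cond volume I), s ∈ I := ae_cond_mem measurableSet_Icc
  calc _ ≤ ∫⁻ _, ∫⁻ _, ENNReal.ofReal (b - a) ^ 2 *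
          ∫⁻ s, ‖deriv f s‖ₑ ^ 2 ∂(cond volume I) ∂(cond volume I) ∂(cond volume I) := by
        refine lintegral_mono_ae ?_
        filter_upwards [hmem] with s hs
        refine lintegral_mono_ae ?_
        filter_upwards [hmem] with t ht using key s hs t ht
    _ = _ := by simp

theorem pi_smul_measure {ι X : Type*} [Fintype ι] [MeasurableSpace X] (c : ι → ℝ≥0∞)
    (hc : ∀ i, c i ≠ ⊤) (ν : ι → Measure X) [∀ i, IsFiniteMeasure (ν i)] :
    Measure.pi (fun i => c i • ν i) = (∏ i, c i) • Measure.pi ν := by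
  have : ∀ i, IsFiniteMeasure (c i • ν i) := fun i => Measure.smul_finite _ (hc i)
  refine Measure.pi_eq fun s _ => ?_
  simp [Measure.pi_pi, Finset.prod_mul_distrib]

theorem cube_eq_preimage (d : ℕ) (l : ℝ) :
    cube d l = WithLp.ofLp ⁻¹' (Set.univ.pi fun _ : Fin d => Set.Icc (-(l / 2)) (l / 2)) := by
  ext x; simp only [cube, Set.mem_ofPred_eq, Set.mem_preimage, Set.mem_pi, Set.mem_univ, true_imp_iff]

theorem isCompact_cube (d : ℕ) (l : ℝ) : IsCompact (cube d l) := by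
  rw [cube_eq_preimage]
  exact (EuclideanSpace.equiv (Fin d) ℝ).toHomeomorph.isCompact_preimage.2
    (isCompact_univ_pi fun _ => isCompact_Icc)

theorem measurableSet_cube (d : ℕ) (l : ℝ) : MeasurableSet (cube d l) :=
  (isCompact_cube d l).measurableSet

theorem cube_mono {l m : ℝ} (h : l ≤ m) : cube d l ⊆ cube d m := fun x hx i =>
  ⟨by linarith [(hx i).1], by linarith [(hx i).2]⟩

theorem volume_cube (d : ℕ) (l : ℝ) : volume (cube d l) = ENNReal.ofReal l ^ d := by
  rw [cube_eq_preimage, (PiLp.volume_preserving_ofLp (Fin d)).measure_preimage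
    (MeasurableSet.univ_pi fun _ => measurableSet_Icc).nullMeasurableSet, volume_pi, Measure.pi_pi]
  simp

theorem cond_cube_eq_map {l : ℝ} (hl : 0 < l) :
    cond volume (cube d l) =
      (Measure.pi fun _ : Fin d => cond (volume : Measure ℝ) (Set.Icc (-(l / 2)) (l / 2))).map
        (WithLp.toLp 2) := by
  have hI : volume (Set.Icc (-(l / 2)) (l / 2)) = ENNReal.ofReal l := by simp
  simp only [ProbabilityTheory.cond]
  rw [pi_smul_measure _ fun _ => by rw [hI]; simpa using hl, Measure.map_smul,
    ← Measure.restrict_pi_pi, ← volume_pi, hI, Finset.prod_const, Finset.card_univ,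
    Fintype.card_fin, volume_cube, ENNReal.inv_pow]
  congr 1
  have h := (PiLp.volume_preserving_toLp (Fin d)).restrict_preimage (measurableSet_cube d l)
  rw [← h.map_eq]
  congr 2
  ext x; simp only [cube, Set.mem_ofPred_eq, Set.mem_preimage, Set.mem_pi, Set.mem_univ, true_imp_iff]

theorem hasFDerivAt_comp_update {ι : Type*} [Fintype ι] [DecidableEq ι] {E : Type*}
    [NormedAddCommGroup E] [NormedSpace ℝ E] {ψ : (ι → E) → ℝ} (hψ : ContDiff ℝ 1 ψ)
    (x : ι → E) (i : ι) (t : E) :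
    HasFDerivAt (fun s => ψ (Function.update x i s))
      ((fderiv ℝ ψ (Function.update x i t)).comp (ContinuousLinearMap.single ℝ (fun _ => E) i)) t := by
  have h1 := (hψ.differentiable one_ne_zero (Function.update x i t)).hasFDerivAt
  refine (h1.comp t (hasFDerivAt_update x t)).congr_fderiv ?_
  ext v
  simp only [ContinuousLinearMap.comp_apply]
  congr 1
  funext j
  by_cases h : j = i
  · subst h; simp
  · simp [h]

theorem contDiff_comp_update {ι : Type*} [Fintype ι] [DecidableEq ι] {E : Type*}
    [NormedAddCommGroup E] [NormedSpace ℝ E] {ψ : (ι → E) → ℝ} (hψ : ContDiff ℝ 1 ψ)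
    (x : ι → E) (i : ι) : ContDiff ℝ 1 fun s => ψ (Function.update x i s) :=
  hψ.comp (contDiff_update 1 x i)

/-- Tensorization over the `d` coordinates of a single particle: the uniform law on the cube is a
product of uniform laws on intervals, and resampling all coordinates gives an independent copy. -/
theorem poincare_cube {l : ℝ} (hl : 0 < l) {f : Space d → ℝ} (hf : ContDiff ℝ 1 f) :
    ∫⁻ s, ∫⁻ t, ‖f s - f t‖ₑ ^ 2 ∂(cond volume (cube d l)) ∂(cond volume (cube d l)) ≤
      ENNReal.ofReal l ^ 2 *
        ∫⁻ s, ∑ j, ‖fderiv ℝ f s (EuclideanSpace.single j 1)‖ₑ ^ 2 ∂(cond volume (cube d l)) := by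
  set I := Set.Icc (-(l / 2)) (l / 2)
  have : IsProbabilityMeasure (cond (volume : Measure ℝ) I) :=
    cond_isProbabilityMeasure_of_finite (by simp [I, hl]) (by simp [I])
  let τ : Fin d → Measure ℝ := fun _ => cond volume I
  have hτ : ∀ j, IsProbabilityMeasure (τ j) := fun _ => this
  let ψ : (Fin d → ℝ) → ℝ := fun x => f (WithLp.toLp 2 x)
  have hψ : ContDiff ℝ 1 ψ := hf.comp (PiLp.contDiff_toLp)
  have hto : Measurable (WithLp.toLp 2 : (Fin d → ℝ) → Space d) :=
    (PiLp.continuous_toLp 2 _).measurable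
  have hcont : ∀ j, Continuous fun s => fderiv ℝ f s (EuclideanSpace.single j 1) := fun j =>
    (hf.continuous_fderiv one_ne_zero).clm_apply continuous_const
  have he : ∀ j, Measurable fun x : Fin d → ℝ =>
      ‖fderiv ℝ f (WithLp.toLp 2 x) (EuclideanSpace.single j 1)‖ₑ ^ 2 := fun j =>
    ((hcont j).measurable.comp hto).enorm.pow_const 2
  have hderiv : ∀ j x s, deriv (fun s => ψ (Function.update x j s)) s =
      fderiv ℝ f (WithLp.toLp 2 (Function.update x j s)) (EuclideanSpace.single j 1) := by
    intro j x s
    have h1 := (hf.differentiable one_ne_zero (WithLp.toLp 2 (Function.update x j s))).hasFDerivAt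
    have h2 : HasDerivAt (fun s => (WithLp.toLp 2 (Function.update x j s) : Space d))
        (EuclideanSpace.single j 1) s := by
      have h3 : (fun s => (WithLp.toLp 2 (Function.update x j s) : Space d)) =
          fun s => WithLp.toLp 2 x + (s - x j) • EuclideanSpace.single j (1 : ℝ) := by
        funext s
        ext k
        by_cases hk : k = j
        · subst hk; simp
        · simp [hk]
      rw [h3]
      simpa using (((hasDerivAt_id s).sub_const (x j)).smul_const
        (EuclideanSpace.single j (1 : ℝ))).const_add (WithLp.toLp 2 x)
    exact (h1.comp_hasDerivAt s h2).deriv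
  have hsingle : ∀ j, resampleEnergy τ {j} ψ ≤ ENNReal.ofReal l ^ 2 * ∫⁻ x,
      ‖fderiv ℝ f (WithLp.toLp 2 x) (EuclideanSpace.single j 1)‖ₑ ^ 2 ∂Measure.pi τ := fun j => by
    refine resampleEnergy_singleton_le τ hψ.continuous.measurable (he j) (by finiteness)
      fun x => ?_
    have h1 := poincare_interval (a := -(l / 2)) (b := l / 2) (by linarith)
      (contDiff_comp_update hψ x j)
    simp only [hderiv] at h1
    rw [show l / 2 - -(l / 2) = l by ring] at h1
    exact h1
  have h := (resampleEnergy_le_sum τ hψ.continuous.measurable Finset.univ).trans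
    (Finset.sum_le_sum fun j _ => hsingle j)
  have hf' := hf.continuous.measurable
  have hD : Measurable fun p : Space d × Space d => ‖f p.1 - f p.2‖ₑ ^ 2 := by fun_prop
  have hE : Measurable fun s => ∑ j, ‖fderiv ℝ f s (EuclideanSpace.single j 1)‖ₑ ^ 2 :=
    Finset.measurable_sum _ fun j _ => (hcont j).measurable.enorm.pow_const 2
  rw [cond_cube_eq_map hl, lintegral_lintegral_map _ hto hD, lintegral_map hE hto,
    lintegral_finsetSum _ fun j _ => he j, Finset.mul_sum]
  simpa only [resampleEnergy, Finset.piecewise_univ] using h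

/-- The Poincaré inequality for the particles indexed by `S`, which are independent and uniform in
a cube. -/
theorem resampleEnergy_cube_le {l : ℝ} (hl : 0 < l) {N : ℕ} (σ : Fin N → Measure (Space d))
    [∀ i, IsProbabilityMeasure (σ i)] (S : Finset (Fin N))
    (hS : ∀ i ∈ S, σ i = cond volume (cube d l)) {ψ : (Fin N → Space d) → ℝ}
    (hψ : ContDiff ℝ 1 ψ) :
    resampleEnergy σ S ψ ≤ ENNReal.ofReal l ^ 2 * ∫⁻ x, ∑ i ∈ S, ∑ j,
      ‖fderiv ℝ ψ x (Pi.single i (EuclideanSpace.single j 1))‖ₑ ^ 2 ∂Measure.pi σ := by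
  have hcont : ∀ i j, Continuous fun x =>
      ‖fderiv ℝ ψ x (Pi.single i (EuclideanSpace.single j (1 : ℝ)))‖ₑ ^ 2 := fun i j =>
    (ENNReal.continuous_pow 2).comp
    ((hψ.continuous_fderiv one_ne_zero).clm_apply continuous_const).enorm
  have hm : ∀ i, Measurable fun x => ∑ j,
      ‖fderiv ℝ ψ x (Pi.single i (EuclideanSpace.single j (1 : ℝ)))‖ₑ ^ 2 := fun i =>
    Finset.measurable_sum _ fun j _ => (hcont i j).measurable
  rw [lintegral_finsetSum _ fun i _ => hm i, Finset.mul_sum]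
  refine (resampleEnergy_le_sum σ hψ.continuous.measurable S).trans
    (Finset.sum_le_sum fun i hi => ?_)
  refine resampleEnergy_singleton_le σ hψ.continuous.measurable (hm i) (by finiteness) fun x => ?_
  have h := poincare_cube hl (contDiff_comp_update hψ x i)
  rw [hS i hi]
  simpa only [(hasFDerivAt_comp_update hψ x i _).fderiv, ContinuousLinearMap.comp_apply,
    ContinuousLinearMap.single_apply] using h

/-! ### Moving one particle; differentiability and measurability of the gradient. -/

theorem move_apply (μ : Config d) (x y : Space d) {B : Set (Space d)} (hB : MeasurableSet B) :
    (move μ x y).1 B = μ.1 (B ∩ {x}ᶜ) + (μ.1 (B ∩ {x}) - 1) * B.indicator 1 x +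
      B.indicator 1 y := by
  have h : (move μ x y).1 B = (μ.1.restrict {x}ᶜ B + (μ.1 {x} - 1) * Measure.dirac x B) +
      Measure.dirac y B := rfl
  rw [h, Measure.restrict_apply hB, Measure.dirac_apply' _ hB, Measure.dirac_apply' _ hB]
  congr 2
  by_cases hx : x ∈ B
  · rw [Set.inter_eq_right.2 (Set.singleton_subset_iff.2 hx)]
  · simp [hx]

theorem move_ofPoints {N : ℕ} (x : Fin N → Space d) (i : Fin N) (y : Space d) :
    move (ofPoints x) (x i) y = ofPoints (Function.update x i y) := by
  refine Subtype.ext (Measure.ext fun B hB => ?_)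
  have hxi := measurableSet_singleton (x i)
  rw [move_apply _ _ _ hB, ofPoints_apply _ hB, ofPoints_apply _ (hB.inter hxi.compl),
    ofPoints_apply _ (hB.inter hxi), ← Finset.add_sum_erase _ _ (Finset.mem_univ i),
    ← Finset.add_sum_erase _ _ (Finset.mem_univ i), ← Finset.add_sum_erase _ _ (Finset.mem_univ i)]
  have h1 : ∑ j ∈ Finset.univ.erase i, B.indicator (1 : Space d → ℝ≥0∞) (Function.update x i y j) =
      ∑ j ∈ Finset.univ.erase i, B.indicator (1 : Space d → ℝ≥0∞) (x j) :=
    Finset.sum_congr rfl fun j hj => by rw [Function.update_of_ne (Finset.ne_of_mem_erase hj)]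
  have h2 : ∀ z, B.indicator (1 : Space d → ℝ≥0∞) z =
      (B ∩ {x i}ᶜ).indicator 1 z + (B ∩ {x i}).indicator 1 z := by
    intro z
    by_cases hz' : z = x i
    · by_cases hz : x i ∈ B <;> simp [hz', hz]
    · by_cases hz : z ∈ B <;> simp [hz, hz']
  rw [h1, Function.update_self, Finset.sum_congr rfl fun j _ => h2 (x j), Finset.sum_add_distrib]
  -- Particle `i` itself contributes `1` to the mass at `x i`, so the truncated subtraction in
  -- `move` is exact, also when several particles sit there.
  by_cases hx : x i ∈ B
  · simp only [Set.mem_inter_iff, hx, Set.mem_compl_iff, Set.mem_singleton_iff, not_true_eq_false,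
      and_false, not_false_eq_true, Set.indicator_of_notMem, Set.indicator_of_mem, and_self,
      Pi.one_apply, mul_one, zero_add, ENNReal.add_sub_cancel_left ENNReal.one_ne_top]
    ring
  · have h3 : B ∩ {x i} = ∅ := by
      ext z; simp only [Set.mem_inter_iff, Set.mem_singleton_iff, Set.mem_empty_iff_false,
        iff_false, not_and]
      rintro hz rfl; exact hx hz
    simp [hx, h3]
    ring

/-- Near the support of a local observable, moving one particle is moving one of finitely many. -/
theorem exists_move_eq {V : Set (Space d)} (hV : IsCompact V) {f : Config d → ℝ}
    (hf : Measurable[sigmaAlg V] f) (μ : Config d) (x : Space d) :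
    ∃ (N : ℕ) (p : Fin N → Space d),
      ∀ y, f (move μ x y) = f (ofPoints (Fin.cons y p : Fin (N + 1) → Space d)) := by
  obtain ⟨N, p, hp⟩ := exists_ofPoints_agree hV ⟨_, μ.2.erase x⟩
  refine ⟨N, p, fun y => eq_of_agree hf fun B hB hBV => ?_⟩
  have h : (move μ x y).1 B = (⟨_, μ.2.erase x⟩ : Config d).1 B + Measure.dirac y B := rfl
  rw [h, hp B hB hBV, ofPoints_apply _ hB, ofPoints_apply _ hB, Fin.sum_univ_succ,
    Measure.dirac_apply' _ hB, add_comm]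
  simp

namespace IsSmoothLocal

variable {f : Config d → ℝ}

theorem differentiableAt_move (hf : IsSmoothLocal f) (μ : Config d) (x v : Space d) (t : ℝ) :
    DifferentiableAt ℝ (fun h : ℝ => f (move μ x (x + h • v))) t := by
  obtain ⟨V, hV, hm⟩ := hf.local_meas
  obtain ⟨N, p, hp⟩ := exists_move_eq hV hm μ x
  simp_rw [hp]
  have h1 := (hf.smooth (N + 1)).differentiable (by simp)
  refine (h1 (Fin.cons (x + t • v) p)).comp t
    (f := fun t : ℝ => (Fin.cons (x + t • v) p : Fin (N + 1) → Space d)) ?_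
  rw [differentiableAt_pi]
  refine Fin.cases ?_ fun i => ?_
  · simp only [Fin.cons_zero]; fun_prop
  · simp

protected theorem measurable (hf : IsSmoothLocal f) : Measurable f :=
  let ⟨_, _, hm⟩ := hf.local_meas
  measurable_of_sigmaAlg hm

end IsSmoothLocal

/-- With `s` the diagonal or its complement, this gives joint measurability in `(μ, x)` of the
masses of `B ∩ {x}` and `B ∩ {x}ᶜ` that occur in `move_apply`. -/
theorem measurable_apply_inter_singleton {B : Set (Space d)} (hB : MeasurableSet B)
    (hb : Bornology.IsBounded B) {s : Set (Space d × Space d)} (hs : MeasurableSet s) :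
    Measurable fun p : Config d × Space d => p.1.1 (B ∩ {z | (p.2, z) ∈ s}) := by
  have h1 : Measurable fun q : (Config d × Space d) × Space d =>
      s.indicator (1 : Space d × Space d → ℝ≥0∞) (q.1.2, q.2) :=
    (measurable_one.indicator hs).comp (by fun_prop)
  have h2 := measurable_lintegral_restrict hB hb
    ((measurable_fst (α := Config d) (β := Space d)).mono le_rfl (sigmaAlg_mono
      (Set.subset_univ B))) h1
  convert h2 using 2 with p
  have h3 : MeasurableSet {z | (p.2, z) ∈ s} := measurable_prodMk_left hs
  rw [show (fun z => s.indicator (1 : Space d × Space d → ℝ≥0∞) (p.2, z)) =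
    {z | (p.2, z) ∈ s}.indicator 1 from rfl, lintegral_indicator_one h3,
    Measure.restrict_apply h3, Set.inter_comm]

theorem measurable_move {V : Set (Space d)} (hb : Bornology.IsBounded V) {α : Type*}
    [MeasurableSpace α] {μ : α → Config d} {x y : α → Space d} (hμ : Measurable μ)
    (hx : Measurable x) (hy : Measurable y) :
    Measurable[_, sigmaAlg V] fun a => move (μ a) (x a) (y a) := by
  refine measurable_sigmaAlg_of_apply fun B hB hBV => ?_
  simp only [move_apply _ _ _ hB]
  have hd : MeasurableSet {q : Space d × Space d | q.2 = q.1} :=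
    measurableSet_eq_fun measurable_snd measurable_fst
  have h1 := (measurable_apply_inter_singleton hB (hb.subset hBV) hd).comp (hμ.prodMk hx)
  have h2 := (measurable_apply_inter_singleton hB (hb.subset hBV) hd.compl).comp (hμ.prodMk hx)
  have h3 : Measurable (B.indicator (1 : Space d → ℝ≥0∞)) := measurable_one.indicator hB
  exact (h2.add ((h1.sub_const 1).mul (h3.comp hx))).add (h3.comp hy)

theorem IsSmoothLocal.measurable_grad {f : Config d → ℝ} (hf : IsSmoothLocal f) :
    Measurable fun p : Config d × Space d => grad f p.1 p.2 := by
  obtain ⟨V, hV, hm⟩ := hf.local_meas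
  refine (PiLp.continuous_toLp 2 _).measurable.comp (measurable_pi_lambda _ fun k => ?_)
  have hmeas : ∀ t : ℝ, Measurable fun p : Config d × Space d =>
      f (move p.1 p.2 (p.2 + t • EuclideanSpace.single k (1 : ℝ))) := fun t =>
    hm.comp (measurable_move hV.isBounded measurable_fst measurable_snd (by fun_prop))
  -- The partial derivative exists everywhere, so it is the pointwise limit of difference quotients
  -- with increments `1 / (n + 1)`, each measurable.
  refine measurable_of_tendsto_metrizable (f := fun (n : ℕ) (p : Config d × Space d) =>
    ((n : ℝ) + 1) * (f (move p.1 p.2 (p.2 + ((n : ℝ) + 1)⁻¹ • EuclideanSpace.single k (1 : ℝ))) -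
      f (move p.1 p.2 (p.2 + (0 : ℝ) • EuclideanSpace.single k (1 : ℝ)))))
    (fun n => ((hmeas _).sub (hmeas 0)).const_mul _) (tendsto_pi_nhds.2 fun p => ?_)
  have h := (hf.differentiableAt_move p.1 p.2 (EuclideanSpace.single k 1) 0).hasDerivAt.tendsto_slope
  have hn : Tendsto (fun n : ℕ => ((n : ℝ) + 1)⁻¹) atTop (𝓝[≠] 0) := by
    refine tendsto_nhdsWithin_iff.2 ⟨?_, Eventually.of_forall fun n => ?_⟩
    · simpa only [one_div] using tendsto_one_div_add_atTop_nhds_zero_nat (𝕜 := ℝ)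
    · exact inv_ne_zero (by positivity)
  refine (h.comp hn).congr fun n => ?_
  simp [slope_def_field, div_eq_inv_mul]

/-- The energy of the gradient of `f` carried by the particles of `μ` in `U`. -/
noncomputable def gradEnergy (U : Set (Space d)) (f : Config d → ℝ) (μ : Config d) : ℝ≥0∞ :=
  ∫⁻ x in U, ‖grad f μ x‖ₑ ^ 2 ∂μ.1

theorem measurable_lintegral_field {U : Set (Space d)} (hU : MeasurableSet U)
    (hb : Bornology.IsBounded U) {G : Config d → Space d → Space d}
    (hG : Measurable fun p : Config d × Space d => G p.1 p.2) :
    Measurable fun μ : Config d => ∫⁻ x in U, ‖G μ x‖ₑ ^ 2 ∂μ.1 :=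
  measurable_lintegral_restrict hU hb (measurable_id.mono le_rfl (sigmaAlg_mono
      (Set.subset_univ U))) (F := fun p => ‖G p.1 p.2‖ₑ ^ 2) (hG.enorm.pow_const 2)

theorem grad_restrictTo {V W : Set (Space d)} (hW : MeasurableSet W) (hVW : V ⊆ W)
    {f : Config d → ℝ} (hm : Measurable[sigmaAlg V] f) (μ : Config d) (x : Space d) :
    grad f (restrictTo hW μ) x = grad f μ x := by
  unfold grad
  congr 2
  funext k
  congr 1
  funext h
  refine eq_of_agree hm fun B hB hBV => ?_
  rw [move_apply _ _ _ hB, move_apply _ _ _ hB,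
    restrictTo_apply hW (Set.inter_subset_left.trans (hBV.trans hVW)),
    restrictTo_apply hW (Set.inter_subset_left.trans (hBV.trans hVW))]

theorem gradEnergy_restrictTo {U V W : Set (Space d)} (hU : MeasurableSet U)
    (hW : MeasurableSet W) (hVW : V ⊆ W)
    (hUW : U ⊆ W) {f : Config d → ℝ} (hm : Measurable[sigmaAlg V] f) (μ : Config d) :
    gradEnergy U f (restrictTo hW μ) = gradEnergy U f μ := by
  unfold gradEnergy
  simp only [grad_restrictTo hW hVW hm]
  simp only [restrictTo]
  rw [Measure.restrict_restrict hU, Set.inter_eq_left.2 hUW]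

theorem enorm_sq_euclidean (v : Space d) : ‖v‖ₑ ^ 2 = ∑ j, ‖v j‖ₑ ^ 2 := by
  simp only [enorm_sq_eq_ofReal]
  rw [← ENNReal.ofReal_sum_of_nonneg fun _ _ => sq_nonneg _, ← ofReal_norm,
    ← ENNReal.ofReal_pow (norm_nonneg _), EuclideanSpace.norm_sq_eq]
  simp

/-- The dictionary between the gradient on configurations and the derivative in labelled positions:
by `move_ofPoints`, moving the particle at `x i` updates coordinate `i`. -/
theorem gradEnergy_ofPoints {U : Set (Space d)} (hU : MeasurableSet U) {f : Config d → ℝ}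
    (hf : IsSmoothLocal f) {N : ℕ} (x : Fin N → Space d) :
    gradEnergy U f (ofPoints x) = ∑ i, U.indicator (fun _ => ∑ j,
      ‖fderiv ℝ (fun y : Fin N → Space d => f (ofPoints y)) x
        (Pi.single i (EuclideanSpace.single j 1))‖ₑ ^ 2) (x i) := by
  have hm : Measurable fun z => U.indicator (fun z => ‖grad f (ofPoints x) z‖ₑ ^ 2) z :=
    ((hf.measurable_grad.comp measurable_prodMk_left).enorm.pow_const 2).indicator hU
  unfold gradEnergy
  rw [← lintegral_indicator hU]
  have h0 : (ofPoints x).1 = ∑ i, Measure.dirac (x i) := rfl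
  rw [h0, lintegral_finsetSum_measure]
  refine Finset.sum_congr rfl fun i _ => ?_
  rw [lintegral_dirac' _ hm]
  by_cases hx : x i ∈ U
  · rw [Set.indicator_of_mem hx, Set.indicator_of_mem hx, enorm_sq_euclidean]
    refine Finset.sum_congr rfl fun j _ => ?_
    congr 2
    show deriv (fun h : ℝ => f (move (ofPoints x) (x i)
      (x i + h • EuclideanSpace.single j (1 : ℝ)))) 0 = _
    simp only [move_ofPoints]
    have h1 := hasFDerivAt_comp_update ((hf.smooth N).of_le (by simp)) x i (x i)
    have h2 : HasDerivAt (fun h : ℝ => x i + h • EuclideanSpace.single j (1 : ℝ))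
        (EuclideanSpace.single j 1) 0 := by
      simpa using ((hasDerivAt_id (0 : ℝ)).smul_const
        (EuclideanSpace.single j (1 : ℝ))).const_add (x i)
    have h3 := HasFDerivAt.comp_hasDerivAt_of_eq (0 : ℝ) h1 h2 (by simp)
    rw [Function.update_eq_self] at h3
    simpa [Function.comp_def] using h3.deriv
  · rw [Set.indicator_of_notMem hx, Set.indicator_of_notMem hx]

/-! ### The Poisson law as a mixture of product laws on cells. -/

/-- The cell `Q` for the indices in `S` and `U \ Q` for the others. -/
def cell (Q U : Set (Space d)) {N : ℕ} (S : Finset (Fin N)) (i : Fin N) : Set (Space d) :=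
  if i ∈ S then Q else U \ Q

theorem cell_of_mem (Q U : Set (Space d)) {N : ℕ} {S : Finset (Fin N)} {i : Fin N} (h : i ∈ S) :
    cell Q U S i = Q := if_pos h

theorem cell_of_notMem (Q U : Set (Space d)) {N : ℕ} {S : Finset (Fin N)} {i : Fin N}
    (h : i ∉ S) : cell Q U S i = U \ Q := if_neg h

theorem measurableSet_cell {Q U : Set (Space d)} (hQ : MeasurableSet Q) (hU : MeasurableSet U)
    {N : ℕ} (S : Finset (Fin N)) (i : Fin N) : MeasurableSet (cell Q U S i) := by
  unfold cell
  split_ifs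
  exacts [hQ, hU.diff hQ]

/-- The law of independent particles, the `i`-th one uniform in `cell Q U S i`. -/
noncomputable def cellLaw (Q U : Set (Space d)) {N : ℕ} (S : Finset (Fin N)) :
    Measure (Fin N → Space d) :=
  Measure.pi fun i => cond volume (cell Q U S i)

theorem smul_cond {α : Type*} [MeasurableSpace α] (μ : Measure α) {s : Set α} (h0 : μ s ≠ 0)
    (ht : μ s ≠ ⊤) : μ s • cond μ s = μ.restrict s := by
  rw [ProbabilityTheory.cond, smul_smul, ENNReal.mul_inv_cancel h0 ht, one_smul]

/-- Each point of `U ^ N` lies in exactly one product of cells, the one whose `S` is the set of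
labels `i` with `x i ∈ Q`. The volumes must be nonzero and finite for the normalized laws to be
probabilities. -/
theorem setLIntegral_pi_eq_sum_cells {Q U : Set (Space d)} (hQ : MeasurableSet Q)
    (hU : MeasurableSet U) (hQU : Q ⊆ U) {N : ℕ}
    (h0 : ∀ (S : Finset (Fin N)) i, volume (cell Q U S i) ≠ 0)
    (ht : ∀ (S : Finset (Fin N)) i, volume (cell Q U S i) ≠ ⊤)
    (F : (Fin N → Space d) → ℝ≥0∞) :
    ∫⁻ x in Set.univ.pi fun _ => U, F x =
      ∑ S : Finset (Fin N), (∏ i, volume (cell Q U S i)) * ∫⁻ x, F x ∂cellLaw Q U S := by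
  have hunion : (Set.univ.pi fun _ : Fin N => U) =
      ⋃ S : Finset (Fin N), Set.univ.pi (cell Q U S) := by
    classical
    ext x
    simp only [Set.mem_pi, Set.mem_univ, true_imp_iff, Set.mem_iUnion]
    constructor
    · intro hx
      refine ⟨Finset.univ.filter fun i => x i ∈ Q, fun i => ?_⟩
      by_cases h : x i ∈ Q
      · rwa [cell_of_mem _ _ (by simpa using h)]
      · rw [cell_of_notMem _ _ (by simpa using h)]
        exact ⟨hx i, h⟩
    · rintro ⟨S, hS⟩ i
      have := hS i
      unfold cell at this
      split_ifs at this
      exacts [hQU this, this.1]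
  have hdisj : Pairwise (Function.onFun Disjoint fun S : Finset (Fin N) =>
      Set.univ.pi (cell Q U S)) := by
    intro S T hST
    refine Set.disjoint_left.2 fun x hS hT => hST ?_
    have key : ∀ R : Finset (Fin N), x ∈ Set.univ.pi (cell Q U R) → ∀ i, i ∈ R ↔ x i ∈ Q := by
      intro R hR i
      have := hR i trivial
      unfold cell at this
      split_ifs at this with h
      · exact ⟨fun _ => this, fun _ => h⟩
      · exact ⟨fun h' => absurd h' h, fun h' => absurd h' this.2⟩
    ext i
    rw [key S hS, key T hT]
  rw [hunion, lintegral_iUnion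
    (fun S => MeasurableSet.univ_pi fun i => measurableSet_cell hQ hU S i) hdisj, tsum_fintype]
  refine Finset.sum_congr rfl fun S _ => ?_
  have hp : ∀ i, IsProbabilityMeasure (cond volume (cell Q U S i)) := fun i =>
    cond_isProbabilityMeasure_of_finite (h0 S i) (ht S i)
  have : (volume : Measure (Fin N → Space d)).restrict (Set.univ.pi (cell Q U S)) =
      (∏ i, volume (cell Q U S i)) • cellLaw Q U S := by
    rw [volume_pi, Measure.restrict_pi_pi, cellLaw, ← pi_smul_measure _ fun i => ht S i]
    congr 1
    funext i
    rw [smul_cond _ (h0 S i) (ht S i)]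
  rw [this, lintegral_smul_measure, smul_eq_mul]

/-- The weight of the event that there are `N` labelled particles in `U`, with those in `Q` labelled
by `S`. -/
noncomputable def cellWeight (ρ : ℝ) (Q U : Set (Space d)) (i : Σ N, Finset (Fin N)) : ℝ≥0∞ :=
  ENNReal.ofReal (Real.exp (-(ρ * (volume U).toReal)) * ρ ^ i.1 / i.1.factorial) *
    ∏ j, volume (cell Q U i.2 j)

theorem restrictTo_ofPoints {U : Set (Space d)} (hU : MeasurableSet U) {N : ℕ}
    {x : Fin N → Space d} (hx : x ∈ Set.univ.pi fun _ => U) :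
    restrictTo hU (ofPoints x) = ofPoints x := by
  refine Subtype.ext (Measure.ext fun B hB => ?_)
  show (ofPoints x).1.restrict U B = _
  rw [Measure.restrict_apply hB, ofPoints_apply _ (hB.inter hU), ofPoints_apply _ hB]
  refine Finset.sum_congr rfl fun i _ => ?_
  have := hx i trivial
  by_cases h : x i ∈ B <;> simp [h, this]

/-- The particles in `U` of a Poisson process are a mixture of independent particles in cells. -/
theorem IsPoisson.map_restrictTo {ρ : ℝ} {P : Measure (Config d)} (hP : IsPoisson ρ P)
    {Q U : Set (Space d)} (hQ : MeasurableSet Q) (hU : MeasurableSet U)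
    (hb : Bornology.IsBounded U) (hQU : Q ⊆ U) (h0 : volume Q ≠ 0) (h0' : volume (U \ Q) ≠ 0) :
    P.map (restrictTo hU) = Measure.sum fun i : Σ N, Finset (Fin N) =>
      cellWeight ρ Q U i • (cellLaw Q U i.2).map ofPoints := by
  have hr : Measurable (restrictTo hU) := measurable_of_sigmaAlg (measurable_restrictTo hU)
  have hUt : volume U ≠ ⊤ := hb.measure_lt_top.ne
  have hc0 : ∀ {N : ℕ} (S : Finset (Fin N)) i, volume (cell Q U S i) ≠ 0 := fun S i => by
    unfold cell; split_ifs; exacts [h0, h0']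
  have hct : ∀ {N : ℕ} (S : Finset (Fin N)) i, volume (cell Q U S i) ≠ ⊤ := fun S i => by
    unfold cell; split_ifs
    exacts [measure_ne_top_of_subset hQU hUt, measure_ne_top_of_subset Set.sdiff_subset hUt]
  ext A hA
  have hF : Measurable[sigmaAlg U] fun μ => A.indicator (1 : Config d → ℝ≥0∞) (restrictTo hU μ) :=
    (measurable_one.indicator hA).comp (measurable_restrictTo hU)
  rw [Measure.map_apply hr hA, ← lintegral_indicator_one (hr hA)]
  have h1 := hP U hU hb _ hF
  have h2 : ∀ N : ℕ, ∫⁻ x in Set.univ.pi fun _ : Fin N => U,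
      A.indicator (1 : Config d → ℝ≥0∞) (restrictTo hU (ofPoints x)) =
      ∫⁻ x in Set.univ.pi fun _ : Fin N => U, A.indicator (1 : Config d → ℝ≥0∞) (ofPoints x) :=
    fun N => setLIntegral_congr_fun (MeasurableSet.univ_pi fun _ => hU) fun x hx => by
      simp only [restrictTo_ofPoints hU hx]
  have h3 : (fun μ => (restrictTo hU ⁻¹' A).indicator (1 : Config d → ℝ≥0∞) μ) =
      fun μ => A.indicator (1 : Config d → ℝ≥0∞) (restrictTo hU μ) := rfl
  rw [h3, h1, Measure.sum_apply _ hA, ENNReal.tsum_sigma']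
  refine tsum_congr fun N => ?_
  rw [h2, setLIntegral_pi_eq_sum_cells hQ hU hQU hc0 hct, tsum_fintype, Finset.mul_sum]
  refine Finset.sum_congr rfl fun S _ => ?_
  rw [Measure.smul_apply, Measure.map_apply measurable_ofPoints hA, smul_eq_mul, cellWeight,
    mul_assoc, ← lintegral_indicator_one (measurable_ofPoints hA)]
  rfl

theorem IsPoisson.isProbabilityMeasure {ρ : ℝ} {P : Measure (Config d)} (hP : IsPoisson ρ P) :
    IsProbabilityMeasure P := by
  -- In the empty window only the term `N = 0` survives, and it equals `1`.
  have h := hP ∅ MeasurableSet.empty Bornology.isBounded_empty 1 measurable_const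
  refine ⟨?_⟩
  simp only [Pi.one_apply, lintegral_const, one_mul, Measure.restrict_apply_univ] at h
  rw [h, tsum_eq_single 0]
  · simp [volume_pi, Measure.pi_pi]
  · intro N hN
    have : Nonempty (Fin N) := ⟨⟨0, Nat.pos_of_ne_zero hN⟩⟩
    simp

/-! ### Equality in law of a local observable and its translate. -/

open Classical in
/-- The map sending every point outside `V` to the cemetery `p`. -/
noncomputable def collapse (V : Set (Space d)) (p x : Space d) : Space d := if x ∈ V then x else p

theorem collapse_of_mem {V : Set (Space d)} {p x : Space d} (h : x ∈ V) : collapse V p x = x :=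
  if_pos h

theorem collapse_of_notMem {V : Set (Space d)} {p x : Space d} (h : x ∉ V) : collapse V p x = p :=
  if_neg h

theorem measurable_collapse {V : Set (Space d)} (hV : MeasurableSet V) (p : Space d) :
    Measurable (collapse V p) :=
  Measurable.ite hV measurable_id measurable_const

theorem eq_collapse {V : Set (Space d)} {p : Space d} (hp : p ∉ V) {u : Config d → ℝ}
    (hu : Measurable[sigmaAlg V] u) {N : ℕ} (x : Fin N → Space d) :
    u (ofPoints x) = u (ofPoints fun i => collapse V p (x i)) := by
  refine eq_of_agree hu fun B hB hBV => ?_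
  rw [ofPoints_apply _ hB, ofPoints_apply _ hB]
  refine Finset.sum_congr rfl fun i _ => ?_
  by_cases h : x i ∈ V
  · rw [collapse_of_mem h]
  · rw [collapse_of_notMem h, Set.indicator_of_notMem fun h' => h (hBV h'),
      Set.indicator_of_notMem fun h' => hp (hBV h')]

theorem translateFun_eq_collapse {V : Set (Space d)} {p : Space d} (hp : p ∉ V) {u : Config d → ℝ}
    (hu : Measurable[sigmaAlg V] u) (h : Space d) {N : ℕ} (x : Fin N → Space d) :
    translateFun h u (ofPoints x) = u (ofPoints fun i => collapse V p (x i - h)) := by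
  unfold translateFun
  rw [translate_ofPoints, eq_collapse hp hu]
  simp only [sub_eq_add_neg]

/-- A uniform point of `Q`, collapsed outside `V`, has the same law as its translate by `-h`,
as soon as `Q` contains both `V` and its translate by `h`. -/
theorem map_collapse_eq {V Q : Set (Space d)} (hV : MeasurableSet V) (hQ : MeasurableSet Q)
    (h0 : volume Q ≠ 0) (ht : volume Q ≠ ⊤) {h : Space d} (hVQ : V ⊆ Q)
    (hhQ : ∀ x, x - h ∈ V → x ∈ Q) (p : Space d) :
    (cond volume Q).map (collapse V p) = (cond volume Q).map fun x => collapse V p (x - h) := by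
  have hm := measurable_collapse hV p
  have hm' : Measurable fun x : Space d => collapse V p (x - h) :=
    hm.comp (measurable_sub_const h)
  have hprob : IsProbabilityMeasure (cond (volume : Measure (Space d)) Q) :=
    cond_isProbabilityMeasure_of_finite h0 ht
  have := Measure.isProbabilityMeasure_map (μ := cond (volume : Measure (Space d)) Q) hm.aemeasurable
  have := Measure.isProbabilityMeasure_map (μ := cond (volume : Measure (Space d)) Q)
    hm'.aemeasurable
  -- For `p ∉ B` the two preimages in `Q` are `V ∩ B` and its translate by `h`, of equal volume.
  -- Sets containing `p` follow by complement, as both laws have mass one.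
  have key : ∀ B, MeasurableSet B → p ∉ B → (cond volume Q).map (collapse V p) B =
      (cond volume Q).map (fun x => collapse V p (x - h)) B := by
    intro B hB hpB
    rw [Measure.map_apply hm hB, Measure.map_apply hm' hB, cond_apply hQ, cond_apply hQ]
    congr 1
    have hmem : ∀ x, collapse V p x ∈ B ↔ x ∈ V ∧ x ∈ B := by
      intro x
      by_cases hx : x ∈ V
      · simp [collapse_of_mem hx, hx]
      · simp [collapse_of_notMem hx, hx, hpB]
    have e1 : Q ∩ collapse V p ⁻¹' B = V ∩ B := by
      ext x
      simp only [Set.mem_inter_iff, Set.mem_preimage, hmem]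
      exact ⟨fun h => h.2, fun h => ⟨hVQ h.1, h⟩⟩
    have e2 : Q ∩ (fun x => collapse V p (x - h)) ⁻¹' B = (fun x => x - h) ⁻¹' (V ∩ B) := by
      ext x
      simp only [Set.mem_inter_iff, Set.mem_preimage, hmem]
      exact ⟨fun h => h.2, fun h => ⟨hhQ _ h.1, h⟩⟩
    rw [e1, e2]
    simp only [sub_eq_add_neg]
    rw [measure_preimage_add_right]
  ext B hB
  by_cases hpB : p ∈ B
  · rw [← compl_compl B, prob_compl_eq_one_sub hB.compl, prob_compl_eq_one_sub hB.compl,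
      key _ hB.compl (by simpa using hpB)]
  · exact key B hB hpB

section Cell

variable {V Q U : Set (Space d)} {N : ℕ} {S : Finset (Fin N)}

theorem isProbabilityMeasure_cond_cell
    (h0 : ∀ i, volume (cell Q U S i) ≠ 0) (ht : ∀ i, volume (cell Q U S i) ≠ ⊤) (i : Fin N) :
    IsProbabilityMeasure (cond (volume : Measure (Space d)) (cell Q U S i)) :=
  cond_isProbabilityMeasure_of_finite (h0 i) (ht i)

theorem ae_mem_cell (hQ : MeasurableSet Q) (hU : MeasurableSet U)
    (h0 : ∀ i, volume (cell Q U S i) ≠ 0) (ht : ∀ i, volume (cell Q U S i) ≠ ⊤) :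
    ∀ᵐ x ∂cellLaw Q U S, ∀ i, x i ∈ cell Q U S i := by
  have := isProbabilityMeasure_cond_cell h0 ht
  refine ae_all_iff.2 fun i => ?_
  exact (measurePreserving_eval (fun i => cond volume (cell Q U S i)) i).quasiMeasurePreserving.ae
    (ae_cond_mem (measurableSet_cell hQ hU S i))

/-- The independent particles of `cellLaw`, seen in `V`, have the same law as their translates. -/
theorem map_cellLaw_eq (hV : MeasurableSet V) (hQ : MeasurableSet Q) (hU : MeasurableSet U)
    (h0 : ∀ i, volume (cell Q U S i) ≠ 0) (ht : ∀ i, volume (cell Q U S i) ≠ ⊤) {h : Space d}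
    (hVQ : V ⊆ Q) (hhQ : ∀ x, x - h ∈ V → x ∈ Q) {p : Space d} (hp : p ∉ V) {u : Config d → ℝ}
    (hu : Measurable[sigmaAlg V] u) :
    (cellLaw Q U S).map (fun x => u (ofPoints x)) =
      (cellLaw Q U S).map fun x => translateFun h u (ofPoints x) := by
  have hprob := isProbabilityMeasure_cond_cell h0 ht
  have hm := measurable_collapse hV p
  have hm' : Measurable fun x : Space d => collapse V p (x - h) :=
    hm.comp (measurable_sub_const h)
  have hu' : Measurable fun x : Fin N → Space d => u (ofPoints x) :=
    (measurable_of_sigmaAlg hu).comp measurable_ofPoints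
  have e1 : (fun x : Fin N → Space d => u (ofPoints x)) =
      (fun x => u (ofPoints x)) ∘ fun x i => collapse V p (x i) :=
    funext fun x => eq_collapse hp hu x
  have e2 : (fun x : Fin N → Space d => translateFun h u (ofPoints x)) =
      (fun x => u (ofPoints x)) ∘ fun x i => collapse V p (x i - h) :=
    funext fun x => translateFun_eq_collapse hp hu h x
  have i1 : ∀ i, IsProbabilityMeasure ((cond volume (cell Q U S i)).map (collapse V p)) := fun i =>
    Measure.isProbabilityMeasure_map hm.aemeasurable
  have i2 : ∀ i, IsProbabilityMeasure
      ((cond volume (cell Q U S i)).map fun x => collapse V p (x - h)) := fun i =>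
    Measure.isProbabilityMeasure_map hm'.aemeasurable
  rw [e2, e1, ← Measure.map_map (g := fun x : Fin N → Space d => u (ofPoints x)) hu' (by fun_prop),
    ← e1, ← Measure.map_map (g := fun x : Fin N → Space d => u (ofPoints x)) hu' (by fun_prop),
    cellLaw, Measure.pi_map_pi (f := fun _ => collapse V p) (fun i => hm.aemeasurable),
    Measure.pi_map_pi (f := fun _ x => collapse V p (x - h)) (fun i => hm'.aemeasurable)]
  congr 2
  funext i
  by_cases hi : i ∈ S
  · have h0' := h0 i
    have ht' := ht i
    rw [cell_of_mem Q U hi] at h0' ht' ⊢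
    exact map_collapse_eq hV hQ h0' ht' hVQ hhQ p
  -- A particle outside `Q` is outside both `V` and its translate, so both maps send it to the
  -- cemetery.
  · rw [cell_of_notMem Q U hi]
    refine Measure.map_congr ?_
    filter_upwards [ae_cond_mem (hU.diff hQ)] with x hx
    rw [collapse_of_notMem fun h' => hx.2 (hVQ h'), collapse_of_notMem fun h' => hx.2 (hhQ _ h')]

/-! ### The estimate on a single cell. -/

/-- Young's inequality for `|a - b| * |a + b|`. It replaces Cauchy–Schwarz because, for fixed `lam`,
it can be summed over cells. -/
theorem enorm_sq_sub_sq_le {lam : ℝ} (hlam : 0 < lam) (a b : ℝ) :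
    ‖a ^ 2 - b ^ 2‖ₑ ≤ ENNReal.ofReal lam * ‖a - b‖ₑ ^ 2 +
      ENNReal.ofReal lam⁻¹ * (‖a‖ₑ ^ 2 + ‖b‖ₑ ^ 2) := by
  simp only [enorm_sq_eq_ofReal]
  rw [← ENNReal.ofReal_add (by positivity) (by positivity), ← ENNReal.ofReal_mul hlam.le,
    ← ENNReal.ofReal_mul (by positivity), ← ENNReal.ofReal_add (by positivity) (by positivity),
    Real.enorm_eq_ofReal_abs]
  refine ENNReal.ofReal_le_ofReal ?_
  have h1 : |a ^ 2 - b ^ 2| = |a - b| * |a + b| := by rw [← abs_mul]; ring_nf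
  rw [h1, ← sq_abs (a - b)]
  have h2 : |a + b| ^ 2 ≤ 2 * (a ^ 2 + b ^ 2) := by rw [sq_abs]; nlinarith [sq_nonneg (a - b)]
  have h3 : 0 ≤ lam⁻¹ * (lam * |a - b| - |a + b| / 2) ^ 2 := by positivity
  have h4 : lam⁻¹ * (lam * |a - b| - |a + b| / 2) ^ 2 =
      lam * |a - b| ^ 2 - |a - b| * |a + b| + lam⁻¹ * (|a + b| ^ 2 / 4) := by
    field_simp
    ring
  have h5 : lam⁻¹ * (|a + b| ^ 2 / 4) ≤ lam⁻¹ * (a ^ 2 + b ^ 2) := by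
    gcongr
    nlinarith [sq_nonneg a, sq_nonneg b]
  linarith

/-- Testing a square against a function that has mean zero when the coordinates in `S` are
resampled. -/
theorem enorm_integral_sq_mul_le {X : Type*} [MeasurableSpace X] {ι : Type*} [Fintype ι]
    [DecidableEq ι] (σ : ι → Measure X) [∀ i, IsProbabilityMeasure (σ i)] (S : Finset ι)
    {ψ w : (ι → X) → ℝ} (hψ : Measurable ψ) (hw : Measurable w) {A B : ℝ} (hA : ∀ x, |ψ x| ≤ A)
    (hB : ∀ x, |w x| ≤ B) (hw0 : ∫ x, w x ∂Measure.pi σ = 0)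
    (hres : ∀ᵐ p ∂(Measure.pi σ).prod (Measure.pi σ), w (S.piecewise p.2 p.1) = w p.2)
    {M : ℝ≥0∞} (hM : ∀ᵐ x ∂Measure.pi σ, ‖w x‖ₑ ≤ M) {lam : ℝ} (hlam : 0 < lam) :
    ‖∫ x, ψ x ^ 2 * w x ∂Measure.pi σ‖ₑ ≤ M * (ENNReal.ofReal lam * resampleEnergy σ S ψ +
      ENNReal.ofReal lam⁻¹ * (2 * ∫⁻ x, ‖ψ x‖ₑ ^ 2 ∂Measure.pi σ)) := by
  set π := (Measure.pi σ).prod (Measure.pi σ)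
  have hfst : MeasurePreserving Prod.fst π (Measure.pi σ) := measurePreserving_fst
  have hex : MeasurePreserving
    (fun p : (ι → X) × (ι → X) => (S.piecewise p.2 p.1, S.piecewise p.1 p.2)) π π :=
    measurePreserving_exchange σ S
  have hpw : Measurable fun p : (ι → X) × (ι → X) => S.piecewise p.2 p.1 :=
    (measurable_finsetPiecewise S).comp measurable_swap
  have hbd : ∀ x y, ‖ψ x ^ 2 * w y‖ ≤ A ^ 2 * B := by
    intro x y
    rw [Real.norm_eq_abs, abs_mul, abs_pow]
    have := hA x
    have := hB y
    have := abs_nonneg (ψ x)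
    have := abs_nonneg (w y)
    gcongr
  have hK1 : Measurable fun p : (ι → X) × (ι → X) => ψ p.1 ^ 2 * w p.1 := by fun_prop
  have hK2 : Measurable fun p : (ι → X) × (ι → X) => ψ (S.piecewise p.2 p.1) ^ 2 * w p.1 := by
    have := hψ.comp hpw
    simp only [Function.comp_def] at this
    fun_prop
  have i1 : Integrable (fun p : (ι → X) × (ι → X) => ψ p.1 ^ 2 * w p.1) π :=
    Integrable.of_bound hK1.aestronglyMeasurable _ (ae_of_all _ fun p => hbd _ _)
  have i2 : Integrable (fun p : (ι → X) × (ι → X) => ψ (S.piecewise p.2 p.1) ^ 2 * w p.1) π :=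
    Integrable.of_bound hK2.aestronglyMeasurable _ (ae_of_all _ fun p => hbd _ _)
  have e1 : ∫ x, ψ x ^ 2 * w x ∂Measure.pi σ = ∫ p, ψ p.1 ^ 2 * w p.1 ∂π := by
    have h := integral_map (μ := π) hfst.aemeasurable (f := fun x => ψ x ^ 2 * w x)
      (by rw [hfst.map_eq]; exact ((hψ.pow_const 2).mul hw).aestronglyMeasurable)
    rwa [hfst.map_eq] at h
  -- After exchanging the coordinates in `S`, the integrand is `ψ x ^ 2` times `w` at the resampled
  -- point, which by `hres` depends on `y` alone. The integral factorizes and the mean of `w`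
  -- vanishes.
  have e2 : ∫ p, ψ (S.piecewise p.2 p.1) ^ 2 * w p.1 ∂π = 0 := by
    have h := integral_map (μ := π) hex.aemeasurable
      (f := fun p => ψ (S.piecewise p.2 p.1) ^ 2 * w p.1)
      (by rw [hex.map_eq]; exact hK2.aestronglyMeasurable)
    rw [hex.map_eq] at h
    rw [h]
    have h2 : ∫ p, ψ (S.piecewise (S.piecewise p.1 p.2) (S.piecewise p.2 p.1)) ^ 2 *
        w (S.piecewise p.2 p.1) ∂π = ∫ p, ψ p.1 ^ 2 * w p.2 ∂π := by
      refine integral_congr_ae ?_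
      filter_upwards [hres] with p hp
      have : S.piecewise (S.piecewise p.1 p.2) (S.piecewise p.2 p.1) = p.1 := by
        funext j
        by_cases hj : j ∈ S <;> simp [Finset.piecewise, hj]
      rw [this, hp]
    rw [h2, integral_prod_mul (fun x => ψ x ^ 2) w, hw0, mul_zero]
  have e3 : ∫ x, ψ x ^ 2 * w x ∂Measure.pi σ =
      ∫ p, (ψ p.1 ^ 2 - ψ (S.piecewise p.2 p.1) ^ 2) * w p.1 ∂π := by
    simp only [sub_mul]
    rw [integral_sub i1 i2, e2, sub_zero, e1]
  have m1 : Measurable fun p : (ι → X) × (ι → X) => ‖ψ p.1 - ψ (S.piecewise p.2 p.1)‖ₑ ^ 2 :=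
    ((hψ.comp measurable_fst).sub (hψ.comp hpw)).enorm.pow_const 2
  have m2 : Measurable fun p : (ι → X) × (ι → X) => ‖ψ p.1‖ₑ ^ 2 := by fun_prop
  have l1 : ∫⁻ p, ‖ψ p.1‖ₑ ^ 2 ∂π = ∫⁻ x, ‖ψ x‖ₑ ^ 2 ∂Measure.pi σ :=
    hfst.lintegral_comp (f := fun x => ‖ψ x‖ₑ ^ 2) (by fun_prop)
  have l2 : ∫⁻ p, ‖ψ (S.piecewise p.2 p.1)‖ₑ ^ 2 ∂π = ∫⁻ p, ‖ψ p.1‖ₑ ^ 2 ∂π :=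
    hex.lintegral_comp m2
  have hMp : ∀ᵐ p ∂π, ‖w p.1‖ₑ ≤ M := hfst.quasiMeasurePreserving.ae hM
  calc ‖∫ x, ψ x ^ 2 * w x ∂Measure.pi σ‖ₑ
      ≤ ∫⁻ p, ‖(ψ p.1 ^ 2 - ψ (S.piecewise p.2 p.1) ^ 2) * w p.1‖ₑ ∂π := by
        rw [e3]; exact enorm_integral_le_lintegral_enorm _
    _ ≤ ∫⁻ p, M * (ENNReal.ofReal lam * ‖ψ p.1 - ψ (S.piecewise p.2 p.1)‖ₑ ^ 2 +
        ENNReal.ofReal lam⁻¹ * (‖ψ p.1‖ₑ ^ 2 + ‖ψ (S.piecewise p.2 p.1)‖ₑ ^ 2)) ∂π := by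
        refine lintegral_mono_ae ?_
        filter_upwards [hMp] with p hp
        rw [enorm_mul, mul_comm]
        exact mul_le_mul' hp (enorm_sq_sub_sq_le hlam _ _)
    _ = _ := by
        have m3 : Measurable fun p : (ι → X) × (ι → X) =>
            ‖ψ p.1‖ₑ ^ 2 + ‖ψ (S.piecewise p.2 p.1)‖ₑ ^ 2 :=
          m2.add ((hψ.comp hpw).enorm.pow_const 2)
        have m4 : Measurable fun p : (ι → X) × (ι → X) =>
            ENNReal.ofReal lam * ‖ψ p.1 - ψ (S.piecewise p.2 p.1)‖ₑ ^ 2 + ENNReal.ofReal lam⁻¹ *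
              (‖ψ p.1‖ₑ ^ 2 + ‖ψ (S.piecewise p.2 p.1)‖ₑ ^ 2) :=
          (m1.const_mul _).add (m3.const_mul _)
        rw [lintegral_const_mul _ m4,
          lintegral_add_left (m1.const_mul _), lintegral_const_mul _ m1,
          lintegral_const_mul _ m3, lintegral_add_left m2, l2, l1, ← two_mul]
        rfl

end Cell

theorem measurable_translateFun {u : Config d → ℝ} (hu : Measurable u) (h : Space d) :
    Measurable (translateFun h u) :=
  hu.comp (measurable_translate (-h))

/-- Almost surely the labels in `S` lie in the cube, so their terms survive the indicator in
`gradEnergy_ofPoints`; the other terms are nonnegative. -/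
theorem lintegral_gradEnergy_cellLaw_ge {m : ℝ} {U : Set (Space d)} (hU : MeasurableSet U) {N : ℕ}
    {S : Finset (Fin N)} (h0 : ∀ i, volume (cell (cube d m) U S i) ≠ 0)
    (ht : ∀ i, volume (cell (cube d m) U S i) ≠ ⊤) {f : Config d → ℝ} (hf : IsSmoothLocal f) :
    ∫⁻ x, ∑ i ∈ S, ∑ j, ‖fderiv ℝ (fun y : Fin N → Space d => f (ofPoints y)) x
        (Pi.single i (EuclideanSpace.single j 1))‖ₑ ^ 2 ∂cellLaw (cube d m) U S ≤
      ∫⁻ x, gradEnergy (cube d m) f (ofPoints x) ∂cellLaw (cube d m) U S := by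
  have hQ := measurableSet_cube d m
  refine lintegral_mono_ae ?_
  filter_upwards [ae_mem_cell hQ hU h0 ht] with x hx
  rw [gradEnergy_ofPoints hQ hf]
  refine le_trans (Finset.sum_le_sum fun i hi => ?_)
    (Finset.sum_le_sum_of_subset (Finset.subset_univ S))
  have hxi := hx i
  rw [cell_of_mem _ _ hi] at hxi
  rw [Set.indicator_of_mem hxi]

theorem enorm_integral_cellLaw_le {l m : ℝ} (hm : 0 < m) (hlm : l ≤ m) {U : Set (Space d)}
    (hU : MeasurableSet U) {N : ℕ}
    {S : Finset (Fin N)} (h0 : ∀ i, volume (cell (cube d m) U S i) ≠ 0)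
    (ht : ∀ i, volume (cell (cube d m) U S i) ≠ ⊤) {h : Space d}
    (hh : ∀ x, x - h ∈ cube d l → x ∈ cube d m) {p : Space d} (hp : p ∉ cube d l)
    {u : Config d → ℝ} (hu : IsSmoothLocal u) (hul : Measurable[sigmaAlg (cube d l)] u)
    {f : Config d → ℝ} (hf : IsSmoothLocal f) {M : ℝ≥0∞}
    (hM : ∀ᵐ x ∂cellLaw (cube d m) U S, ‖u (ofPoints x)‖ₑ ≤ M) {lam : ℝ} (hlam : 0 < lam) :
    ‖∫ x, f (ofPoints x) ^ 2 * (u (ofPoints x) - translateFun h u (ofPoints x))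
        ∂cellLaw (cube d m) U S‖ₑ ≤
      2 * M * (ENNReal.ofReal lam * (ENNReal.ofReal m ^ 2 *
        ∫⁻ x, gradEnergy (cube d m) f (ofPoints x) ∂cellLaw (cube d m) U S) +
        ENNReal.ofReal lam⁻¹ * (2 * ∫⁻ x, ‖f (ofPoints x)‖ₑ ^ 2 ∂cellLaw (cube d m) U S)) := by
  have hV := measurableSet_cube d l
  have hQ := measurableSet_cube d m
  have hVQ := cube_mono (d := d) hlm
  have hprob := isProbabilityMeasure_cond_cell h0 ht
  have hpi : IsProbabilityMeasure (cellLaw (cube d m) U S) := by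
    unfold cellLaw; infer_instance
  obtain ⟨A, hA⟩ := hf.bounded
  obtain ⟨B, hB⟩ := hu.bounded
  have hum : Measurable fun x : Fin N → Space d => u (ofPoints x) :=
    hu.measurable.comp measurable_ofPoints
  have htm : Measurable fun x : Fin N → Space d => translateFun h u (ofPoints x) :=
    (measurable_translateFun hu.measurable h).comp measurable_ofPoints
  have hmap := map_cellLaw_eq hV hQ hU h0 ht hVQ hh hp hul
  -- An essential bound depends only on the law, so it passes from `u` to its translate.
  have hM' : ∀ᵐ x ∂cellLaw (cube d m) U S, ‖translateFun h u (ofPoints x)‖ₑ ≤ M := by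
    have hs : MeasurableSet {r : ℝ | ‖r‖ₑ ≤ M} := measurableSet_le measurable_enorm measurable_const
    have h1 := (ae_map_iff hum.aemeasurable hs).2 hM
    rw [hmap] at h1
    exact (ae_map_iff htm.aemeasurable hs).1 h1
  have hw0 : ∫ x, (u (ofPoints x) - translateFun h u (ofPoints x)) ∂cellLaw (cube d m) U S = 0 := by
    rw [integral_sub
      (Integrable.of_bound hum.aestronglyMeasurable B (ae_of_all _ fun x => hB _))
      (Integrable.of_bound htm.aestronglyMeasurable B (ae_of_all _ fun x => hB _)), sub_eq_zero]
    have h1 := integral_map (μ := cellLaw (cube d m) U S) hum.aemeasurable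
      (f := fun r : ℝ => r) measurable_id.aestronglyMeasurable
    have h2 := integral_map (μ := cellLaw (cube d m) U S) htm.aemeasurable
      (f := fun r : ℝ => r) measurable_id.aestronglyMeasurable
    rw [← h1, ← h2, hmap]
  -- Labels outside `S` are collapsed in both samples, so `u - τ_h u` depends only on the labels in
  -- `S`.
  have hres : ∀ᵐ q ∂(cellLaw (cube d m) U S).prod (cellLaw (cube d m) U S),
      (u (ofPoints (S.piecewise q.2 q.1)) - translateFun h u (ofPoints (S.piecewise q.2 q.1))) =
        u (ofPoints q.2) - translateFun h u (ofPoints q.2) := by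
    have hmem := ae_mem_cell hQ hU h0 ht
    filter_upwards [(measurePreserving_fst (μ := cellLaw (cube d m) U S)
        (ν := cellLaw (cube d m) U S)).quasiMeasurePreserving.ae hmem,
      (measurePreserving_snd (μ := cellLaw (cube d m) U S)
        (ν := cellLaw (cube d m) U S)).quasiMeasurePreserving.ae hmem] with q h1 h2
    have hout : ∀ z ∈ U \ cube d m, collapse (cube d l) p z = p ∧
        collapse (cube d l) p (z - h) = p := fun z hz =>
      ⟨collapse_of_notMem fun h' => hz.2 (hVQ h'), collapse_of_notMem fun h' => hz.2 (hh _ h')⟩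
    rw [eq_collapse hp hul, eq_collapse hp hul q.2, translateFun_eq_collapse hp hul,
      translateFun_eq_collapse hp hul h q.2]
    have key : ∀ i, collapse (cube d l) p (S.piecewise q.2 q.1 i) = collapse (cube d l) p (q.2 i) ∧
        collapse (cube d l) p (S.piecewise q.2 q.1 i - h) =
          collapse (cube d l) p (q.2 i - h) := by
      intro i
      by_cases hi : i ∈ S
      · simp [Finset.piecewise, hi]
      · have h1i := h1 i
        have h2i := h2 i
        rw [cell_of_notMem _ _ hi] at h1i h2i
        simp [Finset.piecewise, hi, hout _ h1i, hout _ h2i]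
    simp only [fun i => (key i).1, fun i => (key i).2]
  have hMw : ∀ᵐ x ∂cellLaw (cube d m) U S,
      ‖u (ofPoints x) - translateFun h u (ofPoints x)‖ₑ ≤ 2 * M := by
    filter_upwards [hM, hM'] with x h1 h2
    rw [two_mul]
    exact enorm_sub_le.trans (add_le_add h1 h2)
  have hfin := enorm_integral_sq_mul_le (fun i => cond volume (cell (cube d m) U S i)) S
    (hf.measurable.comp measurable_ofPoints) (hum.sub htm) (fun x => hA _)
    (B := B + B) (fun x => (abs_sub _ _).trans (add_le_add (hB _) (hB _))) hw0 hres hMw hlam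
  refine hfin.trans ?_
  have hpoin := resampleEnergy_cube_le hm (fun i => cond volume (cell (cube d m) U S i)) S
    (fun i hi => by rw [cell_of_mem _ _ hi])
    (ψ := fun x => f (ofPoints x)) ((hf.smooth N).of_le (by simp))
  have hpoin' := hpoin.trans
    (mul_le_mul_right (lintegral_gradEnergy_cellLaw_ge hU h0 ht hf) (ENNReal.ofReal m ^ 2))
  exact mul_le_mul_right (add_le_add_left (mul_le_mul_right hpoin' _) _) _

/-! ### Summation over cells: the estimate for smooth local functions. -/

theorem abs_apply_le_norm (x : Space d) (i : Fin d) : |x i| ≤ ‖x‖ := PiLp.norm_apply_le x i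

theorem exists_subset_cube {V : Set (Space d)} (hV : Bornology.IsBounded V) (m : ℝ) :
    ∃ L, m < L ∧ V ⊆ cube d L := by
  obtain ⟨R, hR⟩ := hV.exists_norm_le
  refine ⟨max (2 * R) (m + 1), lt_max_of_lt_right (by linarith), fun x hx i => ?_⟩
  have h1 := abs_le.1 ((abs_apply_le_norm x i).trans (hR x hx))
  have h2 := le_max_left (2 * R) (m + 1)
  exact ⟨by linarith [h1.1], by linarith [h1.2]⟩

theorem mem_cube_of_sub_mem {l k : ℝ} {h : Space d} (hk : ‖h‖ ≤ k) (x : Space d)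
    (hx : x - h ∈ cube d l) : x ∈ cube d (l + 2 * k) := by
  intro i
  have h1 := abs_le.1 ((abs_apply_le_norm h i).trans hk)
  have h2 := hx i
  simp only [PiLp.sub_apply, Set.mem_Icc] at h2
  exact ⟨by linarith [h1.1, h2.1], by linarith [h1.2, h2.2]⟩

theorem translateFun_restrictTo {V W : Set (Space d)} (hW : MeasurableSet W) {h : Space d}
    (hh : ∀ x, x - h ∈ V → x ∈ W) {u : Config d → ℝ} (hu : Measurable[sigmaAlg V] u)
    (μ : Config d) : translateFun h u (restrictTo hW μ) = translateFun h u μ := by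
  refine eq_of_agree hu fun B hB hBV => ?_
  rw [translate_apply _ _ hB, translate_apply _ _ hB, restrictTo_apply hW]
  intro x hx
  exact hh x (by rw [sub_eq_add_neg]; exact hBV hx)

theorem apply_restrictTo {β : Type*} [MeasurableSpace β] [MeasurableSingletonClass β]
    {V W : Set (Space d)} (hW : MeasurableSet W) (hVW : V ⊆ W) {f : Config d → β}
    (hf : Measurable[sigmaAlg V] f) (μ : Config d) : f (restrictTo hW μ) = f μ :=
  eq_of_agree hf fun _ _ hBV => restrictTo_apply hW (hBV.trans hVW) μ

section Mixture

variable {ρ : ℝ} {P : Measure (Config d)} {Q U : Set (Space d)}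

theorem IsPoisson.lintegral_eq_tsum (hP : IsPoisson ρ P)
    (hQ : MeasurableSet Q) (hU : MeasurableSet U)
    (hb : Bornology.IsBounded U) (hQU : Q ⊆ U) (h0 : volume Q ≠ 0) (h0' : volume (U \ Q) ≠ 0)
    {H : Config d → ℝ≥0∞} (hH : Measurable H) (hr : ∀ μ, H (restrictTo hU μ) = H μ) :
    ∫⁻ μ, H μ ∂P = ∑' i : Σ N, Finset (Fin N), cellWeight ρ Q U i *
      ∫⁻ x, H (ofPoints x) ∂cellLaw Q U i.2 := by
  have hrm : Measurable (restrictTo hU) := measurable_of_sigmaAlg (measurable_restrictTo hU)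
  rw [← lintegral_congr hr, ← lintegral_map hH hrm, hP.map_restrictTo hQ hU hb hQU h0 h0',
    lintegral_sum_measure]
  refine tsum_congr fun i => ?_
  rw [lintegral_smul_measure, lintegral_map hH measurable_ofPoints, smul_eq_mul]

theorem IsPoisson.enorm_integral_le_tsum (hP : IsPoisson ρ P)
    (hQ : MeasurableSet Q) (hU : MeasurableSet U)
    (hb : Bornology.IsBounded U) (hQU : Q ⊆ U) (h0 : volume Q ≠ 0) (h0' : volume (U \ Q) ≠ 0)
    {H : Config d → ℝ} (hH : Measurable H) (hr : ∀ μ, H (restrictTo hU μ) = H μ)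
    (hi : Integrable H P) :
    ‖∫ μ, H μ ∂P‖ₑ ≤ ∑' i : Σ N, Finset (Fin N), cellWeight ρ Q U i *
      ‖∫ x, H (ofPoints x) ∂cellLaw Q U i.2‖ₑ := by
  have hrm : Measurable (restrictTo hU) := measurable_of_sigmaAlg (measurable_restrictTo hU)
  have hi' : Integrable H (P.map (restrictTo hU)) := by
    rw [integrable_map_measure hH.aestronglyMeasurable hrm.aemeasurable]
    exact hi.congr (ae_of_all _ fun μ => (hr μ).symm)
  have h1 : ∫ μ, H μ ∂P = ∫ μ, H μ ∂P.map (restrictTo hU) := by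
    rw [integral_map hrm.aemeasurable hH.aestronglyMeasurable]
    exact integral_congr_ae (ae_of_all _ fun μ => (hr μ).symm)
  rw [hP.map_restrictTo hQ hU hb hQU h0 h0'] at h1 hi'
  rw [h1, integral_sum_measure hi']
  refine enorm_tsum_le_tsum_enorm.trans (ENNReal.tsum_le_tsum fun i => ?_)
  rw [integral_smul_measure, integral_map measurable_ofPoints.aemeasurable hH.aestronglyMeasurable,
    smul_eq_mul, enorm_mul]
  gcongr
  rw [Real.enorm_eq_ofReal ENNReal.toReal_nonneg]
  exact ENNReal.ofReal_toReal_le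

theorem cellWeight_ne_zero (hρ : 0 < ρ) (h0 : volume Q ≠ 0) (h0' : volume (U \ Q) ≠ 0)
    (i : Σ N, Finset (Fin N)) : cellWeight ρ Q U i ≠ 0 := by
  refine mul_ne_zero ?_ (Finset.prod_ne_zero_iff.2 fun j _ => ?_)
  · rw [Ne, ENNReal.ofReal_eq_zero, not_le]
    positivity
  · unfold cell; split_ifs; exacts [h0, h0']

/-- Every cell has positive weight in the mixture, so its law inherits the almost sure properties of
`P`. This brings the essential supremum of `u` under `P` down to each cell. -/
theorem IsPoisson.ae_cellLaw (hP : IsPoisson ρ P) (hρ : 0 < ρ)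
    (hQ : MeasurableSet Q) (hU : MeasurableSet U)
    (hb : Bornology.IsBounded U) (hQU : Q ⊆ U) (h0 : volume Q ≠ 0) (h0' : volume (U \ Q) ≠ 0)
    {p : Config d → Prop} (hp : MeasurableSet {μ | p μ}) (hr : ∀ μ, p (restrictTo hU μ) ↔ p μ)
    (h : ∀ᵐ μ ∂P, p μ) {N : ℕ} (S : Finset (Fin N)) :
    ∀ᵐ x ∂cellLaw Q U S, p (ofPoints x) := by
  have hrm : Measurable (restrictTo hU) := measurable_of_sigmaAlg (measurable_restrictTo hU)
  have h1 : ∀ᵐ μ ∂P.map (restrictTo hU), p μ := by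
    rw [ae_map_iff hrm.aemeasurable hp]
    simpa only [hr] using h
  rw [hP.map_restrictTo hQ hU hb hQU h0 h0', Measure.ae_sum_iff] at h1
  have h2 := h1 ⟨N, S⟩
  rw [Measure.ae_ennreal_smul_measure_iff (cellWeight_ne_zero hρ h0 h0' _),
    ae_map_iff measurable_ofPoints.aemeasurable hp] at h2
  exact h2

end Mixture

/-- The estimate for smooth local functions, in a form that is linear in `f ^ 2`. -/
theorem IsPoisson.enorm_integral_sq_mul_sub_translateFun_le {ρ : ℝ} {P : Measure (Config d)}
    (hP : IsPoisson ρ P) (hρ : 0 < ρ) (hd : d ≠ 0) {l m : ℝ} (hm : 0 < m) (hlm : l ≤ m)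
    {h : Space d} (hh : ∀ x, x - h ∈ cube d l → x ∈ cube d m) {u : Config d → ℝ}
    (hu : IsSmoothLocal u) (hul : Measurable[sigmaAlg (cube d l)] u)
    {f : Config d → ℝ} (hf : IsSmoothLocal f) {lam : ℝ} (hlam : 0 < lam) :
    ‖∫ μ, f μ ^ 2 * (u μ - translateFun h u μ) ∂P‖ₑ ≤
      2 * eLpNorm u ⊤ P * (ENNReal.ofReal lam * (ENNReal.ofReal m ^ 2 *
        ∫⁻ μ, gradEnergy (cube d m) f μ ∂P) +
        ENNReal.ofReal lam⁻¹ * (2 * ∫⁻ μ, ‖f μ‖ₑ ^ 2 ∂P)) := by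
  have hPp := hP.isProbabilityMeasure
  obtain ⟨V, hV, hfV⟩ := hf.local_meas
  -- The window must see all of `f`, and `m < L` is strict so that `U \ Q` has positive volume,
  -- which uses `d ≠ 0`.
  obtain ⟨L, hL, hVU⟩ := exists_subset_cube hV.isBounded m
  have hQ := measurableSet_cube d m
  have hU := measurableSet_cube d L
  have hb := (isCompact_cube d L).isBounded
  have hQU := cube_mono (d := d) hL.le
  have hlU := (cube_mono (d := d) hlm).trans hQU
  have h0 : volume (cube d m) ≠ 0 := by
    rw [volume_cube]
    exact pow_ne_zero _ (by simpa using hm)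
  have ht : volume (cube d m) ≠ ⊤ := (isCompact_cube d m).measure_lt_top.ne
  have hUt : volume (cube d L) ≠ ⊤ := (isCompact_cube d L).measure_lt_top.ne
  have h0' : volume (cube d L \ cube d m) ≠ 0 := by
    rw [measure_sdiff hQU hQ.nullMeasurableSet ht, volume_cube, volume_cube, Ne, tsub_eq_zero_iff_le,
      not_le]
    exact ENNReal.pow_lt_pow_left hd ((ENNReal.ofReal_lt_ofReal_iff (hm.trans hL)).2 hL)
  have hc0 : ∀ {N : ℕ} (S : Finset (Fin N)) i, volume (cell (cube d m) (cube d L) S i) ≠ 0 :=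
    fun S i => by unfold cell; split_ifs; exacts [h0, h0']
  have hct : ∀ {N : ℕ} (S : Finset (Fin N)) i, volume (cell (cube d m) (cube d L) S i) ≠ ⊤ :=
    fun S i => by
      unfold cell; split_ifs
      exacts [ht, measure_ne_top_of_subset Set.sdiff_subset hUt]
  obtain ⟨p, hp⟩ : ∃ p : Space d, p ∉ cube d l := by
    refine ⟨WithLp.toLp 2 fun _ => |l| + 1, fun hp => ?_⟩
    have h1 := (hp ⟨0, Nat.pos_of_ne_zero hd⟩).2
    simp only at h1
    linarith [le_abs_self l, abs_nonneg l]
  obtain ⟨A, hA⟩ := hf.bounded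
  obtain ⟨B, hB⟩ := hu.bounded
  have hum := hu.measurable
  have htm := measurable_translateFun hum h
  have hfm := hf.measurable
  have hHm : Measurable fun μ => f μ ^ 2 * (u μ - translateFun h u μ) := by fun_prop
  have hHi : Integrable (fun μ => f μ ^ 2 * (u μ - translateFun h u μ)) P := by
    refine Integrable.of_bound hHm.aestronglyMeasurable (A ^ 2 * (B + B)) (ae_of_all _ fun μ => ?_)
    rw [Real.norm_eq_abs, abs_mul, abs_pow]
    have := hA μ
    have := (abs_sub (u μ) (translateFun h u μ)).trans (add_le_add (hB _) (hB _))
    have := abs_nonneg (f μ)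
    gcongr
  have hfr := apply_restrictTo hU hVU hfV
  have hM : ∀ᵐ μ ∂P, ‖u μ‖ₑ ≤ eLpNorm u ⊤ P := by
    rw [eLpNorm_exponent_top]; exact enorm_ae_le_eLpNormEssSup u P
  have hmeasM : MeasurableSet {μ | ‖u μ‖ₑ ≤ eLpNorm u ⊤ P} :=
    measurableSet_le hum.enorm measurable_const
  have hE : Measurable (gradEnergy (cube d m) f) :=
    measurable_lintegral_field hQ (isCompact_cube d m).isBounded hf.measurable_grad
  refine (hP.enorm_integral_le_tsum hQ hU hb hQU h0 h0' hHm (fun μ => ?_) hHi).trans ?_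
  · rw [hfr, apply_restrictTo hU hlU hul, translateFun_restrictTo hU (fun x hx => hQU (hh x hx)) hul]
  rw [hP.lintegral_eq_tsum hQ hU hb hQU h0 h0' hE
      (gradEnergy_restrictTo hQ hU hVU hQU hfV),
    hP.lintegral_eq_tsum hQ hU hb hQU h0 h0' (H := fun μ => ‖f μ‖ₑ ^ 2) (by fun_prop)
      (fun μ => by rw [hfr]), ← ENNReal.tsum_mul_left, ← ENNReal.tsum_mul_left,
    ← ENNReal.tsum_mul_left, ← ENNReal.tsum_mul_left, ← ENNReal.tsum_add, ← ENNReal.tsum_mul_left]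
  refine ENNReal.tsum_le_tsum fun i => ?_
  have hcell := enorm_integral_cellLaw_le hm hlm hU (hc0 i.2) (hct i.2) hh hp hu hul hf
    (hP.ae_cellLaw hρ hQ hU hb hQU h0 h0' hmeasM
      (fun μ => by rw [apply_restrictTo hU hlU hul]) hM i.2) hlam
  refine (mul_le_mul_right hcell _).trans (le_of_eq ?_)
  ring

/-! ### Passage to `H¹₀` and optimization in `lam`. -/

theorem enorm_sq_le_two_mul {E : Type*} [NormedAddCommGroup E] (a b : E) :
    ‖a‖ₑ ^ 2 ≤ 2 * ‖a - b‖ₑ ^ 2 + 2 * ‖b‖ₑ ^ 2 := by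
  have h1 : ‖a‖ ^ 2 ≤ 2 * ‖a - b‖ ^ 2 + 2 * ‖b‖ ^ 2 := by
    have h := norm_add_le (a - b) b
    rw [sub_add_cancel] at h
    nlinarith [sq_nonneg (‖a - b‖ - ‖b‖), norm_nonneg a]
  simp only [← ofReal_norm]
  rw [← ENNReal.ofReal_pow (norm_nonneg _), ← ENNReal.ofReal_pow (norm_nonneg _),
    ← ENNReal.ofReal_pow (norm_nonneg _), ← ENNReal.ofReal_ofNat 2,
    ← ENNReal.ofReal_mul (by norm_num), ← ENNReal.ofReal_mul (by norm_num),
    ← ENNReal.ofReal_add (by positivity) (by positivity)]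
  exact ENNReal.ofReal_le_ofReal h1

/-- For use with `a = f` and `b = φ n`: the first term vanishes as `n → ∞` with `eta` fixed, the
second as `eta → ∞` afterwards. -/
theorem enorm_sq_sub_sq_le_of_small {eta : ℝ} (heta : 0 < eta) (a b : ℝ) :
    ‖a ^ 2 - b ^ 2‖ₑ ≤
      ENNReal.ofReal (1 + eta) * ‖b - a‖ₑ ^ 2 + ENNReal.ofReal eta⁻¹ * ‖a‖ₑ ^ 2 := by
  simp only [enorm_sq_eq_ofReal]
  rw [← ENNReal.ofReal_mul (by positivity), ← ENNReal.ofReal_mul (by positivity),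
    ← ENNReal.ofReal_add (by positivity) (by positivity), Real.enorm_eq_ofReal_abs]
  refine ENNReal.ofReal_le_ofReal ?_
  have h1 : 0 ≤ eta⁻¹ * (eta * (b - a) + a) ^ 2 := by positivity
  have h2 : 0 ≤ eta⁻¹ * (eta * (b - a) - a) ^ 2 := by positivity
  have h3 : eta⁻¹ * (eta * (b - a) + a) ^ 2 = eta * (b - a) ^ 2 + 2 * (b - a) * a + eta⁻¹ * a ^ 2 := by
    field_simp
    ring
  have h4 : eta⁻¹ * (eta * (b - a) - a) ^ 2 = eta * (b - a) ^ 2 - 2 * (b - a) * a + eta⁻¹ * a ^ 2 := by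
    field_simp
    ring
  rw [abs_le]
  constructor <;> nlinarith [sq_nonneg (b - a)]

theorem energyOn_le_two_mul {P : Measure (Config d)} {U : Set (Space d)} (hU : MeasurableSet U)
    (hb : Bornology.IsBounded U) {F G : Config d → Space d → Space d}
    (hG : Measurable fun p : Config d × Space d => G p.1 p.2) :
    energyOn P U F ≤ 2 * energyOn P Set.univ (fun μ x => F μ x - G μ x) + 2 * energyOn P U G := by
  have hm : ∀ μ, Measurable fun x => 2 * ‖G μ x‖ₑ ^ 2 := fun μ =>
    ((hG.comp measurable_prodMk_left).enorm.pow_const 2).const_mul 2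
  have hout := measurable_lintegral_field hU hb hG
  unfold energyOn
  rw [← lintegral_const_mul' _ _ ENNReal.ofNat_ne_top, ← lintegral_const_mul _ hout,
    ← lintegral_add_right _ (hout.const_mul 2)]
  refine lintegral_mono fun μ => ?_
  rw [← lintegral_const_mul' _ _ ENNReal.ofNat_ne_top, ← lintegral_const_mul' _ _ ENNReal.ofNat_ne_top]
  refine (lintegral_mono fun x => enorm_sq_le_two_mul (F μ x) (G μ x)).trans ?_
  rw [lintegral_add_right _ (hm μ)]
  gcongr
  exact Set.subset_univ U

theorem lintegral_enorm_sq_eq_eLpNorm {α : Type*} [MeasurableSpace α] (μ : Measure α) (f : α → ℝ) :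
    ∫⁻ x, ‖f x‖ₑ ^ 2 ∂μ = eLpNorm f 2 μ ^ 2 := by
  rw [eLpNorm_eq_lintegral_rpow_enorm_toReal two_ne_zero ENNReal.ofNat_ne_top,
    ← ENNReal.rpow_natCast, ← ENNReal.rpow_mul]
  norm_num

/-- Optimization over `lam`: for `A = 0` let `lam → ∞`, otherwise balance the two terms. -/
theorem sq_le_of_forall_pos {x M A : ℝ} (hx : 0 ≤ x) (hA : 0 ≤ A)
    (h : ∀ lam : ℝ, 0 < lam → x ≤ 2 * M * (2 * lam * A + 4 * lam⁻¹)) :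
    x ^ 2 ≤ 128 * M ^ 2 * A := by
  rcases hA.eq_or_lt with rfl | hA
  · have hlim : Tendsto (fun lam : ℝ => 2 * M * (2 * lam * 0 + 4 * lam⁻¹)) atTop (𝓝 0) := by
      have := (tendsto_inv_atTop_zero (𝕜 := ℝ)).const_mul (2 * M * 4)
      rw [mul_zero] at this
      refine this.congr fun lam => by ring
    have h0 : x ≤ 0 := ge_of_tendsto hlim ((eventually_gt_atTop 0).mono fun lam hlam => h lam hlam)
    rw [le_antisymm h0 hx]
    simp
  -- With `lam ^ 2 * A = 2` both terms equal `4 / lam`, so the bound is `16 * M / lam`, whose square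
  -- is `256 * M ^ 2 * A / 2`.
  · have hs : 0 < √(2 / A) := by positivity
    have h1 := h _ hs
    have h2 : √(2 / A) ^ 2 = 2 / A := Real.sq_sqrt (by positivity)
    have h3 : (2 * M * (2 * √(2 / A) * A + 4 * (√(2 / A))⁻¹)) ^ 2 = 128 * M ^ 2 * A := by
      have h4 : 2 * √(2 / A) * A + 4 * (√(2 / A))⁻¹ = 8 * (√(2 / A))⁻¹ := by
        have : 2 * √(2 / A) * A = 2 * (√(2 / A) ^ 2 * A) * (√(2 / A))⁻¹ := by field_simp
        rw [this, h2]
        field_simp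
        ring
      rw [h4, mul_pow, mul_pow, mul_pow, inv_pow, h2]
      field_simp
      ring
    rw [← h3]
    gcongr

/-- The estimate for the square of an element of `H¹₀`, in a form that is linear in the square. -/
theorem HasH10Gradient.enorm_integral_sq_mul_le {ρ : ℝ} {P : Measure (Config d)}
    (hP : IsPoisson ρ P) (hρ : 0 < ρ) (hd : d ≠ 0) {l m : ℝ} (hm : 0 < m) (hlm : l ≤ m)
    {h : Space d} (hh : ∀ x, x - h ∈ cube d l → x ∈ cube d m) {u : Config d → ℝ}
    (hu : IsSmoothLocal u) (hul : Measurable[sigmaAlg (cube d l)] u)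
    {f : Config d → ℝ} {G : Config d → Space d → Space d} (hf : HasH10Gradient P f G)
    (hf1 : ∫⁻ μ, ‖f μ‖ₑ ^ 2 ∂P = 1) {lam : ℝ} (hlam : 0 < lam) :
    ‖∫ μ, f μ ^ 2 * (u μ - translateFun h u μ) ∂P‖ₑ ≤
      2 * eLpNorm u ⊤ P * (ENNReal.ofReal lam * (ENNReal.ofReal m ^ 2 *
        (2 * energyOn P (cube d m) G)) + ENNReal.ofReal lam⁻¹ * 4) := by
  have hPp := hP.isProbabilityMeasure
  obtain ⟨φ, hφ, hφf, hφG⟩ := hf.approx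
  obtain ⟨B, hB⟩ := hu.bounded
  have hB0 : 0 ≤ B := (abs_nonneg _).trans (hB (ofPoints (N := 0) Fin.elim0))
  have hum := hu.measurable
  have htm := measurable_translateFun hum h
  set w : Config d → ℝ := fun μ => u μ - translateFun h u μ
  have hwm : Measurable w := hum.sub htm
  have hwB : ∀ μ, ‖w μ‖ ≤ 2 * B := fun μ => by
    rw [two_mul]
    exact (abs_sub (u μ) (translateFun h u μ)).trans (add_le_add (hB _) (hB _))
  have hwB' : ∀ μ, ‖w μ‖ₑ ≤ ENNReal.ofReal (2 * B) := fun μ => by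
    rw [← ofReal_norm]; exact ENNReal.ofReal_le_ofReal (hwB μ)
  have hM : eLpNorm u ⊤ P ≠ ⊤ :=
    (memLp_top_of_bound hum.aestronglyMeasurable B (ae_of_all _ hB)).eLpNorm_ne_top
  have hint : ∀ {v : Config d → ℝ}, MemLp v 2 P → Integrable (fun μ => v μ ^ 2 * w μ) P :=
    fun hv => hv.integrable_sq.mul_bdd (c := 2 * B) hwm.aestronglyMeasurable (ae_of_all _ hwB)
  let δ : ℕ → ℝ≥0∞ := fun n => ∫⁻ μ, ‖φ n μ - f μ‖ₑ ^ 2 ∂P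
  let ε : ℕ → ℝ≥0∞ := fun n => energyOn P Set.univ fun μ x => grad (φ n) μ x - G μ x
  have hδ : Tendsto δ atTop (𝓝 0) := by
    have h1 := ((ENNReal.continuous_pow 2).tendsto 0).comp hφf
    rw [zero_pow two_ne_zero] at h1
    refine h1.congr fun n => ?_
    exact (lintegral_enorm_sq_eq_eLpNorm P (φ n - f)).symm
  -- The smooth estimate for `φ n` plus the cost of replacing `f ^ 2` by `φ n ^ 2`. Its energy and
  -- mass are compared with those of the limit by `enorm_sq_le_two_mul`, which only costs a factor
  -- `2`.
  have hstep : ∀ (eta : ℝ), 0 < eta → ∀ n, ‖∫ μ, f μ ^ 2 * w μ ∂P‖ₑ ≤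
      2 * eLpNorm u ⊤ P * (ENNReal.ofReal lam * (ENNReal.ofReal m ^ 2 *
        (2 * ε n + 2 * energyOn P (cube d m) G)) + ENNReal.ofReal lam⁻¹ * (2 * (2 * δ n + 2))) +
        ENNReal.ofReal (2 * B) * (ENNReal.ofReal (1 + eta) * δ n + ENNReal.ofReal eta⁻¹) := by
    intro eta heta n
    obtain ⟨hs, hL2, -⟩ := hφ n
    have hfae := hf.memLp.aestronglyMeasurable.aemeasurable
    have h1 : ‖∫ μ, f μ ^ 2 * w μ ∂P‖ₑ ≤ ‖∫ μ, φ n μ ^ 2 * w μ ∂P‖ₑ +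
        ‖∫ μ, (f μ ^ 2 - φ n μ ^ 2) * w μ ∂P‖ₑ := by
      have : ∫ μ, f μ ^ 2 * w μ ∂P = ∫ μ, φ n μ ^ 2 * w μ ∂P +
          ∫ μ, (f μ ^ 2 - φ n μ ^ 2) * w μ ∂P := by
        simp only [sub_mul]
        rw [integral_sub (hint hf.memLp) (hint hL2)]
        ring
      rw [this]
      exact enorm_add_le _ _
    have h2 : ‖∫ μ, (f μ ^ 2 - φ n μ ^ 2) * w μ ∂P‖ₑ ≤
        ENNReal.ofReal (2 * B) * (ENNReal.ofReal (1 + eta) * δ n + ENNReal.ofReal eta⁻¹) := by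
      refine (enorm_integral_le_lintegral_enorm _).trans ?_
      calc ∫⁻ μ, ‖(f μ ^ 2 - φ n μ ^ 2) * w μ‖ₑ ∂P
          ≤ ∫⁻ μ, ENNReal.ofReal (2 * B) * (ENNReal.ofReal (1 + eta) * ‖φ n μ - f μ‖ₑ ^ 2 +
            ENNReal.ofReal eta⁻¹ * ‖f μ‖ₑ ^ 2) ∂P := by
            refine lintegral_mono fun μ => ?_
            rw [enorm_mul, mul_comm]
            exact mul_le_mul' (hwB' μ) (enorm_sq_sub_sq_le_of_small heta _ _)
        _ = _ := by
            rw [lintegral_const_mul' _ _ ENNReal.ofReal_ne_top,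
              lintegral_add_right' _ ((hfae.enorm.pow_const 2).const_mul _),
              lintegral_const_mul' _ _ ENNReal.ofReal_ne_top,
              lintegral_const_mul' _ _ ENNReal.ofReal_ne_top, hf1, mul_one]
    have h3 : ∫⁻ μ, ‖φ n μ‖ₑ ^ 2 ∂P ≤ 2 * δ n + 2 := by
      refine (lintegral_mono fun μ => enorm_sq_le_two_mul (φ n μ) (f μ)).trans ?_
      rw [lintegral_add_right' _ ((hfae.enorm.pow_const 2).const_mul _),
        lintegral_const_mul' _ _ ENNReal.ofNat_ne_top,
        lintegral_const_mul' _ _ ENNReal.ofNat_ne_top, hf1, mul_one]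
    have h4 : ∫⁻ μ, gradEnergy (cube d m) (φ n) μ ∂P ≤ 2 * ε n + 2 * energyOn P (cube d m) G :=
      energyOn_le_two_mul (F := grad (φ n)) (measurableSet_cube d m)
        (isCompact_cube d m).isBounded hf.measurable_grad
    have h5 := hP.enorm_integral_sq_mul_sub_translateFun_le hρ hd hm hlm hh hu hul hs hlam
    refine h1.trans (add_le_add (h5.trans ?_) h2)
    gcongr
  have hlim_n : ∀ eta : ℝ, 0 < eta → ‖∫ μ, f μ ^ 2 * w μ ∂P‖ₑ ≤
      2 * eLpNorm u ⊤ P * (ENNReal.ofReal lam * (ENNReal.ofReal m ^ 2 *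
        (2 * energyOn P (cube d m) G)) + ENNReal.ofReal lam⁻¹ * 4) +
        ENNReal.ofReal (2 * B) * ENNReal.ofReal eta⁻¹ := by
    intro eta heta
    refine ge_of_tendsto' (x := (atTop : Filter ℕ)) ?_ (hstep eta heta)
    have t1 : Tendsto (fun n => 2 * ε n + 2 * energyOn P (cube d m) G) atTop
        (𝓝 (2 * energyOn P (cube d m) G)) := by
      have := (ENNReal.Tendsto.const_mul (a := 2) hφG (Or.inr ENNReal.ofNat_ne_top)).add_const
        (2 * energyOn P (cube d m) G)
      rwa [mul_zero, zero_add] at this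
    have t2 : Tendsto (fun n => 2 * (2 * δ n + 2)) atTop (𝓝 4) := by
      have := ENNReal.Tendsto.const_mul (a := 2) ((ENNReal.Tendsto.const_mul (a := 2) hδ
        (Or.inr ENNReal.ofNat_ne_top)).add_const 2) (Or.inr ENNReal.ofNat_ne_top)
      rwa [mul_zero, zero_add, show (2 : ℝ≥0∞) * 2 = 4 by norm_num] at this
    have t3 : Tendsto (fun n => ENNReal.ofReal (1 + eta) * δ n + ENNReal.ofReal eta⁻¹) atTop
        (𝓝 (ENNReal.ofReal eta⁻¹)) := by
      have := (ENNReal.Tendsto.const_mul (a := ENNReal.ofReal (1 + eta)) hδ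
        (Or.inr ENNReal.ofReal_ne_top)).add_const (ENNReal.ofReal eta⁻¹)
      rwa [mul_zero, zero_add] at this
    have hc : 2 * eLpNorm u ⊤ P ≠ ⊤ := ENNReal.mul_ne_top ENNReal.ofNat_ne_top hM
    refine (ENNReal.Tendsto.const_mul (Tendsto.add
      (ENNReal.Tendsto.const_mul (ENNReal.Tendsto.const_mul t1 (Or.inr (by finiteness)))
        (Or.inr ENNReal.ofReal_ne_top))
      (ENNReal.Tendsto.const_mul t2 (Or.inr ENNReal.ofReal_ne_top))) (Or.inr hc)).add
      (ENNReal.Tendsto.const_mul t3 (Or.inr ENNReal.ofReal_ne_top))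
  have hlim : Tendsto (fun eta : ℝ => 2 * eLpNorm u ⊤ P * (ENNReal.ofReal lam *
      (ENNReal.ofReal m ^ 2 * (2 * energyOn P (cube d m) G)) + ENNReal.ofReal lam⁻¹ * 4) +
        ENNReal.ofReal (2 * B) * ENNReal.ofReal eta⁻¹) atTop
      (𝓝 (2 * eLpNorm u ⊤ P * (ENNReal.ofReal lam *
      (ENNReal.ofReal m ^ 2 * (2 * energyOn P (cube d m) G)) + ENNReal.ofReal lam⁻¹ * 4))) := by
    have t1 : Tendsto (fun eta : ℝ => ENNReal.ofReal eta⁻¹) atTop (𝓝 0) := by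
      have := ENNReal.tendsto_ofReal (tendsto_inv_atTop_zero (𝕜 := ℝ))
      rwa [ENNReal.ofReal_zero] at this
    have := (ENNReal.Tendsto.const_mul t1 (Or.inr (ENNReal.ofReal_ne_top (r := 2 * B)))).const_add
      (2 * eLpNorm u ⊤ P * (ENNReal.ofReal lam *
      (ENNReal.ofReal m ^ 2 * (2 * energyOn P (cube d m) G)) + ENNReal.ofReal lam⁻¹ * 4))
    rwa [mul_zero, add_zero] at this
  exact ge_of_tendsto hlim ((eventually_gt_atTop 0).mono hlim_n)

theorem translateFun_zero (u : Config d → ℝ) : translateFun 0 u = u := by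
  funext μ
  simp [translateFun, translate_zero]

theorem integrable_and_sq_integral_le (d : ℕ) (ρ : ℝ) (P : Measure (Config d)) (hρ : 0 < ρ)
    (hP : IsPoisson ρ P) (u : Config d → ℝ) (l : ℝ) (hl : 0 ≤ l) (hu : IsSmoothLocal u)
    (hul : Measurable[sigmaAlg (cube d l)] u) (k : ℝ) (h : Space d) (hk : ‖h‖ ≤ k)
    (g : Config d → ℝ) (G : Config d → Space d → Space d) (hg : 0 ≤ᵐ[P] g)
    (hg1 : ∫ μ, g μ ∂P = 1) (hG : HasH10Gradient P (fun μ => √(g μ)) G) :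
    Integrable (fun μ => g μ * (u μ - translateFun h u μ)) P ∧
      ENNReal.ofReal ((∫ μ, g μ * (u μ - translateFun h u μ) ∂P) ^ 2) ≤
        ENNReal.ofReal (128 * ((l + 2 * k) * (eLpNorm u ⊤ P).toReal) ^ 2) *
          energyOn P (cube d (l + 2 * k)) G := by
  have hgi : Integrable g P := by
    -- A non-integrable function has integral `0` by convention, which contradicts `hg1`.
    by_contra hne
    rw [integral_undef hne] at hg1
    exact zero_ne_one hg1
  obtain ⟨B, hB⟩ := hu.bounded
  have hum := hu.measurable
  have htm := measurable_translateFun hum h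
  refine ⟨hgi.mul_bdd (c := B + B) (hum.sub htm).aestronglyMeasurable (ae_of_all _ fun μ =>
    (abs_sub (u μ) (translateFun h u μ)).trans (add_le_add (hB _) (hB _))), ?_⟩
  have hk0 : 0 ≤ k := (norm_nonneg h).trans hk
  -- For `h = 0` the left side vanishes. Otherwise `k > 0` and `d ≠ 0`, so the cube is nondegenerate
  -- as the cell decomposition requires.
  rcases eq_or_ne h 0 with rfl | hh0
  · simp [translateFun_zero]
  have hkpos : 0 < k := (norm_pos_iff.2 hh0).trans_le hk
  have hd : d ≠ 0 := by
    rintro rfl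
    exact hh0 (Subsingleton.elim _ _)
  set m := l + 2 * k with hm_def
  have hm : 0 < m := by positivity
  have hf1 : ∫⁻ μ, ‖√(g μ)‖ₑ ^ 2 ∂P = 1 := by
    rw [← ENNReal.ofReal_one, ← hg1, ofReal_integral_eq_lintegral_ofReal hgi hg]
    refine lintegral_congr_ae ?_
    filter_upwards [hg] with μ hμ
    rw [enorm_sq_eq_ofReal, Real.sq_sqrt hμ]
  have hsq : ∫ μ, g μ * (u μ - translateFun h u μ) ∂P =
      ∫ μ, √(g μ) ^ 2 * (u μ - translateFun h u μ) ∂P := by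
    refine integral_congr_ae ?_
    filter_upwards [hg] with μ hμ
    rw [Real.sq_sqrt hμ]
  have key := fun (lam : ℝ) (hlam : 0 < lam) =>
    HasH10Gradient.enorm_integral_sq_mul_le hP hρ hd hm (by linarith : l ≤ m)
      (fun x hx => mem_cube_of_sub_mem hk x hx) hu hul hG hf1 hlam
  rw [← hsq] at key
  rw [← enorm_sq_eq_ofReal]
  set I := ∫ μ, g μ * (u μ - translateFun h u μ) ∂P
  have hM : eLpNorm u ⊤ P ≠ ⊤ := by
    have := hP.isProbabilityMeasure
    exact (memLp_top_of_bound hum.aestronglyMeasurable B (ae_of_all _ hB)).eLpNorm_ne_top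
  set E := energyOn P (cube d m) G
  obtain ⟨M, hM'⟩ : ∃ M : ℝ, M = (eLpNorm u ⊤ P).toReal := ⟨_, rfl⟩
  have hM0 : 0 ≤ M := hM' ▸ ENNReal.toReal_nonneg
  have hMo : eLpNorm u ⊤ P = ENNReal.ofReal M := by rw [hM', ENNReal.ofReal_toReal hM]
  rw [hMo] at key
  rw [← hM']
  -- The case `M = 0` is separate because the right side is then `0` even for infinite energy; for
  -- `M > 0` infinite energy makes it infinite.
  rcases hM0.eq_or_lt with hM00 | hMpos
  · have := key 1 one_pos
    rw [← hM00, ENNReal.ofReal_zero, mul_zero, zero_mul, nonpos_iff_eq_zero] at this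
    simp [this]
  by_cases hE : E = ⊤
  · rw [hE, ENNReal.mul_top]
    · exact le_top
    · rw [Ne, ENNReal.ofReal_eq_zero, not_le]
      positivity
  obtain ⟨e, he⟩ : ∃ e : ℝ, e = E.toReal := ⟨_, rfl⟩
  have he0 : 0 ≤ e := he ▸ ENNReal.toReal_nonneg
  have hEo : E = ENNReal.ofReal e := by rw [he, ENNReal.ofReal_toReal hE]
  rw [hEo] at key ⊢
  have hreal : ∀ lam : ℝ, 0 < lam → |I| ≤ 2 * M * (2 * lam * (m ^ 2 * e) + 4 * lam⁻¹) := by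
    intro lam hlam
    have h1 := key lam hlam
    rw [Real.enorm_eq_ofReal_abs, ← ENNReal.ofReal_ofNat 2, ← ENNReal.ofReal_ofNat 4,
      ← ENNReal.ofReal_pow hm.le, ← ENNReal.ofReal_mul (by positivity),
      ← ENNReal.ofReal_mul (by positivity), ← ENNReal.ofReal_mul (by positivity),
      ← ENNReal.ofReal_mul (by positivity), ← ENNReal.ofReal_mul (by positivity),
      ← ENNReal.ofReal_add (by positivity) (by positivity),
      ← ENNReal.ofReal_mul (by positivity), ENNReal.ofReal_le_ofReal_iff (by positivity)] at h1
    linarith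
  have h2 := sq_le_of_forall_pos (abs_nonneg I) (by positivity) hreal
  rw [sq_abs] at h2
  rw [enorm_sq_eq_ofReal, ← ENNReal.ofReal_mul (by positivity)]
  refine ENNReal.ofReal_le_ofReal (h2.trans (le_of_eq ?_))
  ring

end PoissonConfig

theorem proposition5p2 (d : ℕ) :
    ∃ C : ℝ, 0 < C ∧
      ∀ (ρ : ℝ) (P : Measure (PoissonConfig.Config d)), 0 < ρ → PoissonConfig.IsPoisson ρ P →
      ∀ (u : PoissonConfig.Config d → ℝ) (l : ℝ), 0 ≤ l → PoissonConfig.IsSmoothLocal u →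
        Measurable[PoissonConfig.sigmaAlg (PoissonConfig.cube d l)] u →
      ∀ (k : ℝ) (h : PoissonConfig.Space d), ‖h‖ ≤ k →
      ∀ (g : PoissonConfig.Config d → ℝ)
        (G : PoissonConfig.Config d → PoissonConfig.Space d → PoissonConfig.Space d),
        0 ≤ᵐ[P] g → ∫ μ, g μ ∂P = 1 →
        PoissonConfig.HasH10Gradient P (fun μ => √(g μ)) G →
        Integrable (fun μ => g μ * (u μ - PoissonConfig.translateFun h u μ)) P ∧
        ENNReal.ofReal ((∫ μ, g μ * (u μ - PoissonConfig.translateFun h u μ) ∂P) ^ 2) ≤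
          ENNReal.ofReal (C * ((l + 2 * k) * (eLpNorm u ⊤ P).toReal) ^ 2) *
            PoissonConfig.energyOn P (PoissonConfig.cube d (l + 2 * k)) G :=
  ⟨128, by norm_num, fun ρ P hρ hP u l hl hu hul k h hk g G hg hg1 hG =>
    PoissonConfig.integrable_and_sq_integral_le d ρ P hρ hP u l hl hu hul k h hk g G hg hg1 hG⟩
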